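/- Fix a mass $m>0$ and put $\omega(k)=(k^2+m^2)^{1/2}$. Let $\mathcal F=\bigoplus_{n\ge 0}L^2_{\rm sym}(\mathbb R^n)$ be the symmetric Fock space over $L^2(\mathbb R)$, with annihilation operators $(a(k)\psi)_n(p_1,\dots,p_n)=\sqrt{n+1}\,\psi_{n+1}(k,p_1,\dots,p_n)$, and let $H_0=\int\omega(k)a^*(k)a(k)\,dk$ be the free Hamiltonian, i.e. multiplication of the $n$-particle component by $\omega(k_1)+\dots+\omega(k_n)$ on its maximal domain. Let $\mathcal F_{+2}=D(H_0)$ with the inner product $\langle (H_0+1)x,(H_0+1)y\rangle$, and let $\mathcal F_{-2}$ be the space of continuous conjugate-linear functionals on $\mathcal F_{+2}$ with the dual norm; $\mathcal F\subset\mathcal F_{-2}$ by $v\mapsto\langle\,\cdot\,,v\rangle$. Let $g:\mathbb R^2\to\mathbb R$, $(x,t)\mapsto g(x,t)$, be infinitely differentiable with compact support and $g\ge 0$, and let $$V_g(t)=\int dx\,g(x,t):\!\phi^4(x)\!:\,,\qquad \phi(x)=\frac1{\sqrt{4\pi}}\int e^{-ikx}\,[a^*(k)+a(-k)]\,\omega(k)^{-1/2}\,dk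 ,$$ that is, as a sesquilinear form, $$\langle\varphi,V_g(t)\psi\rangle=\sum_{j=0}^4\binom4j\int \frac{1}{(4\pi)^2}\Big(\int e^{-ix\sum_{i=1}^4 k_i}g(x,t)\,dx\Big)\prod_{i=1}^4\omega(k_i)^{-1/2}\,\big\langle a(k_1)\cdots a(k_j)\varphi,\;a(-k_{j+1})\cdots a(-k_4)\psi\big\rangle\,dk_1\cdots dk_4 .$$ Then for every $t\in\mathbb R$ the sums and integrals in this formula converge absolutely for all $\varphi,\psi\in\mathcal F_{+2}$, and $H_g(t)=H_0+V_g(t)$, i.e. $(H_g(t)\psi)(\varphi)=\langle\varphi,H_0\psi\rangle+\langle\varphi,V_g(t)\psi\rangle$, is a bounded operator from $\mathcal F_{+2}$ to $\mathcal F_{-2}$ that maps $D_0=\bigcap_n D(H_0^n)$ into $\mathcal F$. The map $t\mapsto H_g(t)$ from $\mathbb R$ to the bounded operators from $\mathcal F_{+2}$ to $\mathcal F_{-2}$ is infinitely differentiable in the operator norm. In particular, for every $M\in\mathbb R$ the map $t\mapsto H_g(t)+M\mathbf 1$ is twice differentiable with continuous second derivative in this norm. -/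

import Mathlib

open MeasureTheory
open scoped ContDiff InnerProductSpace ComplexConjugate

noncomputable section

namespace PhiFour

/-- The `n`-particle space `L²(ℝⁿ)` (functions of `n` momenta, not yet symmetrized).
For `n = 0` the underlying measure space is a single point of mass one, so this is `ℂ`. -/
abbrev Sector (n : ℕ) : Type := Lp ℂ 2 (volume : Measure (Fin n → ℝ))

/-- The full Fock space: the Hilbert sum of all the spaces `L²(ℝⁿ)`. -/
abbrev FullFock : Type := lp Sector 2

/-- The symmetric (bosonic) part of the full Fock space: every component is invariant under
all permutations of its arguments. -/
def symmetricPart : Submodule ℂ FullFock where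
  carrier := {ψ | ∀ (n : ℕ) (σ : Equiv.Perm (Fin n)),
    (fun k : Fin n → ℝ => ψ n (k ∘ σ)) =ᵐ[volume] ψ n}
  zero_mem' := by
    intro n σ
    have h0 : ((0 : Sector n) : (Fin n → ℝ) → ℂ) =ᵐ[volume] 0 := Lp.coeFn_zero _ _ _
    have hσ := (volume_measurePreserving_piCongrLeft (fun _ : Fin n => ℝ) σ.symm).quasiMeasurePreserving
    have h1 := hσ.ae h0
    filter_upwards [h0, h1] with k hk hk1
    have e : (MeasurableEquiv.piCongrLeft (fun _ : Fin n => ℝ) σ.symm) k = k ∘ σ := by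
      ext i
      have := MeasurableEquiv.piCongrLeft_apply_apply (β := fun _ : Fin n => ℝ) σ.symm k (σ i)
      simpa using this
    rw [e] at hk1
    change (0 : Sector n) (k ∘ σ) = (0 : Sector n) k
    rw [hk, hk1]; rfl
  add_mem' := by
    intro a b ha hb n σ
    have h0 : ((a n + b n : Sector n) : (Fin n → ℝ) → ℂ) =ᵐ[volume] a n + b n := Lp.coeFn_add _ _
    have hσ := (volume_measurePreserving_piCongrLeft (fun _ : Fin n => ℝ) σ.symm).quasiMeasurePreserving
    have h1 := hσ.ae h0
    filter_upwards [h0, h1, ha n σ, hb n σ] with k hk hk1 hka hkb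
    have e : (MeasurableEquiv.piCongrLeft (fun _ : Fin n => ℝ) σ.symm) k = k ∘ σ := by
      ext i
      have := MeasurableEquiv.piCongrLeft_apply_apply (β := fun _ : Fin n => ℝ) σ.symm k (σ i)
      simpa using this
    rw [e] at hk1
    change (a n + b n : Sector n) (k ∘ σ) = (a n + b n : Sector n) k
    rw [hk, hk1, Pi.add_apply, Pi.add_apply, hka, hkb]
  smul_mem' := by
    intro c a ha n σ
    have h0 : ((c • a n : Sector n) : (Fin n → ℝ) → ℂ) =ᵐ[volume] c • (a n : (Fin n → ℝ) → ℂ) :=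
      Lp.coeFn_smul _ _
    have hσ := (volume_measurePreserving_piCongrLeft (fun _ : Fin n => ℝ) σ.symm).quasiMeasurePreserving
    have h1 := hσ.ae h0
    filter_upwards [h0, h1, ha n σ] with k hk hk1 hka
    have e : (MeasurableEquiv.piCongrLeft (fun _ : Fin n => ℝ) σ.symm) k = k ∘ σ := by
      ext i
      have := MeasurableEquiv.piCongrLeft_apply_apply (β := fun _ : Fin n => ℝ) σ.symm k (σ i)
      simpa using this
    rw [e] at hk1
    change (c • a n : Sector n) (k ∘ σ) = (c • a n : Sector n) k
    rw [hk, hk1, Pi.smul_apply, Pi.smul_apply, hka]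

/-- The symmetric Fock space `ℱ` over `L²(ℝ)`. -/
abbrev Fock : Type := symmetricPart

/-- A representative of the `n`-particle component of a Fock space vector. -/
def component (ψ : Fock) (n : ℕ) : (Fin n → ℝ) → ℂ := (ψ : FullFock) n

/-- The one-particle energy `ω(k) = (k² + m²)^{1/2}`. -/
def omega (m k : ℝ) : ℝ := Real.sqrt (k ^ 2 + m ^ 2)

/-- The graph of the free Hamiltonian `H₀ = ∫ ω(k) a*(k) a(k) dk`, which multiplies the
`n`-particle component by `ω(k₁) + ⋯ + ω(kₙ)`: all pairs `(ψ, η)` of Fock space vectors with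
`η = H₀ ψ`. -/
def freeGraph (m : ℝ) : Submodule ℂ (Fock × Fock) where
  carrier := {x | ∀ n : ℕ, component x.2 n =ᵐ[volume]
    fun k => ((∑ i, omega m (k i) : ℝ) : ℂ) * component x.1 n k}
  zero_mem' := by
    intro n
    have h0 : ((0 : Sector n) : (Fin n → ℝ) → ℂ) =ᵐ[volume] 0 := Lp.coeFn_zero _ _ _
    filter_upwards [h0] with k hk
    change (0 : Sector n) k = _ * (0 : Sector n) k
    rw [hk]; simp
  add_mem' := by
    intro a b ha hb n
    have h1 : ((((a.1 : FullFock) n) + ((b.1 : FullFock) n) : Sector n) : (Fin n → ℝ) → ℂ)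
      =ᵐ[volume] component a.1 n + component b.1 n := Lp.coeFn_add _ _
    have h2 : ((((a.2 : FullFock) n) + ((b.2 : FullFock) n) : Sector n) : (Fin n → ℝ) → ℂ)
      =ᵐ[volume] component a.2 n + component b.2 n := Lp.coeFn_add _ _
    filter_upwards [h1, h2, ha n, hb n] with k hk1 hk2 hka hkb
    change (((a.2 : FullFock) n) + ((b.2 : FullFock) n) : Sector n) k =
      _ * (((a.1 : FullFock) n) + ((b.1 : FullFock) n) : Sector n) k
    rw [hk1, hk2, Pi.add_apply, Pi.add_apply, hka, hkb]; ring
  smul_mem' := by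
    intro c a ha n
    have h1 : ((c • ((a.1 : FullFock) n) : Sector n) : (Fin n → ℝ) → ℂ)
      =ᵐ[volume] c • component a.1 n := Lp.coeFn_smul _ _
    have h2 : ((c • ((a.2 : FullFock) n) : Sector n) : (Fin n → ℝ) → ℂ)
      =ᵐ[volume] c • component a.2 n := Lp.coeFn_smul _ _
    filter_upwards [h1, h2, ha n] with k hk1 hk2 hka
    change (c • ((a.2 : FullFock) n) : Sector n) k = _ * (c • ((a.1 : FullFock) n) : Sector n) k
    rw [hk1, hk2, Pi.smul_apply, Pi.smul_apply, hka]; simp only [smul_eq_mul]; ring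

theorem fock_ext {ψ η : Fock} (h : ∀ n, component ψ n =ᵐ[volume] component η n) : ψ = η := by
  apply Subtype.ext
  apply lp.ext
  funext n
  exact Lp.ext (h n)

theorem component_zero (n : ℕ) : component 0 n =ᵐ[volume] 0 :=
  (Lp.coeFn_zero _ _ _ : ((0 : Sector n) : (Fin n → ℝ) → ℂ) =ᵐ[volume] 0)

theorem component_add (ψ η : Fock) (n : ℕ) :
    component (ψ + η) n =ᵐ[volume] component ψ n + component η n :=
  Lp.coeFn_add ((ψ : FullFock) n) ((η : FullFock) n)

theorem freeGraph_single_valued (m : ℝ) (x : Fock × Fock) (hx : x ∈ freeGraph m)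
    (h : x.1 = 0) : x.2 = 0 := by
  apply fock_ext
  intro n
  filter_upwards [hx n, component_zero n] with k hk h0
  rw [hk, h, h0]; simp

/-- The free Hamiltonian `H₀`, an unbounded operator in Fock space with its maximal domain. -/
def freeH (m : ℝ) : Fock →ₗ.[ℂ] Fock := (freeGraph m).toLinearPMap

theorem freeH_graph (m : ℝ) : (freeH m).graph = freeGraph m :=
  Submodule.toLinearPMap_graph_eq _ (freeGraph_single_valued m)

/-- The domain of the power `H₀ⁿ`. -/
def domPow (m : ℝ) : ℕ → Set Fock
  | 0 => Set.univ
  | n + 1 => {ψ | ∃ h : ψ ∈ (freeH m).domain, freeH m ⟨ψ, h⟩ ∈ domPow m n}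

/-- `D₀ = ⋂ₙ D(H₀ⁿ)`. -/
def domInfty (m : ℝ) : Set Fock := ⋂ n, domPow m n

/-- `H₀ + 1` as a linear map on `D(H₀)`. -/
def shiftedH (m : ℝ) : (freeH m).domain →ₗ[ℂ] Fock := (freeH m).toFun + (freeH m).domain.subtype

theorem freeH_component (m : ℝ) (x : (freeH m).domain) (n : ℕ) :
    component (freeH m x) n =ᵐ[volume]
      fun k => ((∑ i, omega m (k i) : ℝ) : ℂ) * component x n k := by
  have h : (((x : Fock), freeH m x) : Fock × Fock) ∈ (freeH m).graph :=
    LinearPMap.mem_graph (freeH m) x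
  rw [freeH_graph] at h
  exact h n

theorem shiftedH_component (m : ℝ) (x : (freeH m).domain) (n : ℕ) :
    component (shiftedH m x) n =ᵐ[volume]
      fun k => (((∑ i, omega m (k i)) + 1 : ℝ) : ℂ) * component x n k := by
  have h1 := component_add (freeH m x) x n
  filter_upwards [h1, freeH_component m x n] with k hk1 hk2
  change component (freeH m x + x) n k = _
  rw [hk1, Pi.add_apply, hk2]; push_cast; ring

theorem omega_nonneg (m k : ℝ) : 0 ≤ omega m k := Real.sqrt_nonneg _

theorem energy_nonneg (m : ℝ) {n : ℕ} (k : Fin n → ℝ) : 0 ≤ ∑ i, omega m (k i) :=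
  Finset.sum_nonneg fun i _ => omega_nonneg m (k i)

theorem norm_fock_le {ψ η : Fock}
    (h : ∀ n, ∀ᵐ k, ‖component ψ n k‖ ≤ ‖component η n k‖) : ‖ψ‖ ≤ ‖η‖ := by
  have hs : ∀ n, ‖(ψ : FullFock) n‖ ≤ ‖(η : FullFock) n‖ := fun n =>
    Lp.norm_le_norm_of_ae_le (h n)
  exact lp.norm_mono (p := 2) (by norm_num) hs

theorem norm_le_shiftedH (m : ℝ) (x : (freeH m).domain) : ‖(x : Fock)‖ ≤ ‖shiftedH m x‖ := by
  apply norm_fock_le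
  intro n
  filter_upwards [shiftedH_component m x n] with k hk
  rw [hk, norm_mul, Complex.norm_real, Real.norm_eq_abs,
    abs_of_nonneg (by linarith [energy_nonneg m k])]
  nlinarith [energy_nonneg m k, norm_nonneg (component x n k)]

theorem shiftedH_injective (m : ℝ) : Function.Injective (shiftedH m) := by
  rw [injective_iff_map_eq_zero]
  intro x hx
  have h := norm_le_shiftedH m x
  rw [hx, norm_zero] at h
  exact Subtype.ext (norm_le_zero_iff.mp h)

/-- The space `ℱ₊₂ = D(H₀)`; its Hilbert space structure is given below. -/
def FPlus (m : ℝ) : Type := (freeH m).domain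

/-- `ℱ₊₂` carries the vector space structure of `D(H₀)` and the norm `‖x‖₊₂ = ‖(H₀ + 1) x‖`. -/
instance (m : ℝ) : NormedAddCommGroup (FPlus m) :=
  NormedAddCommGroup.induced (freeH m).domain Fock (shiftedH m) (shiftedH_injective m)

/-- `ℱ₊₂` carries the inner product `⟨(H₀ + 1) x, (H₀ + 1) y⟩`. -/
instance (m : ℝ) : InnerProductSpace ℂ (FPlus m) where
  toModule := inferInstanceAs (Module ℂ (freeH m).domain)
  norm_smul_le c x :=
    ((congrArg norm ((shiftedH m).map_smul c x)).trans (norm_smul c (shiftedH m x))).le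
  inner x y := inner ℂ (shiftedH m x) (shiftedH m y)
  norm_sq_eq_re_inner x := norm_sq_eq_re_inner (𝕜 := ℂ) (shiftedH m x)
  conj_inner_symm x y := inner_conj_symm (𝕜 := ℂ) (shiftedH m x) (shiftedH m y)
  add_left x y z :=
    (congrArg (fun v => inner ℂ v (shiftedH m z)) ((shiftedH m).map_add x y)).trans
      (inner_add_left (𝕜 := ℂ) (shiftedH m x) (shiftedH m y) (shiftedH m z))
  smul_left x y c :=
    (congrArg (fun v => inner ℂ v (shiftedH m y)) ((shiftedH m).map_smul c x)).trans
      (inner_smul_left (𝕜 := ℂ) (shiftedH m x) (shiftedH m y) c)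

theorem inner_FPlus (m : ℝ) (x y : FPlus m) :
    inner ℂ x y = inner ℂ (shiftedH m x) (shiftedH m y) := rfl

theorem norm_FPlus (m : ℝ) (x : FPlus m) : ‖x‖ = ‖shiftedH m x‖ := rfl

/-- The free Hamiltonian as a linear map on `ℱ₊₂ = D(H₀)`. -/
def freeHLin (m : ℝ) : FPlus m →ₗ[ℂ] Fock where
  toFun x := freeH m x
  map_add' x y := (freeH m).map_add x y
  map_smul' c x := (freeH m).map_smul c x

/-- The inclusion `ℱ₊₂ ⊆ ℱ`, as a linear map. -/
def toFock (m : ℝ) : FPlus m →ₗ[ℂ] Fock where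
  toFun x := (freeH m).domain.subtype x
  map_add' x y := (freeH m).domain.subtype.map_add x y
  map_smul' c x := (freeH m).domain.subtype.map_smul c x

theorem norm_toFock_le (m : ℝ) (x : FPlus m) : ‖toFock m x‖ ≤ ‖x‖ := norm_le_shiftedH m x

/-- The space `ℱ₋₂` of continuous conjugate-linear functionals on `ℱ₊₂`, with the dual norm. -/
abbrev FMinus (m : ℝ) : Type := FPlus m →L⋆[ℂ] ℂ

/-- The inclusion `ℱ₊₂ ⊆ ℱ`, as a bounded operator. -/
def inclPlus (m : ℝ) : FPlus m →L[ℂ] Fock :=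
  (toFock m).mkContinuous 1 fun x => by rw [one_mul]; exact norm_toFock_le m x

/-- The inclusion `ℱ ⊆ ℱ₋₂`: the vector `v` is the functional `w ↦ ⟨w, v⟩`. -/
def inclMinus (m : ℝ) : Fock →L[ℂ] FMinus m :=
  LinearMap.mkContinuous
    { toFun := fun v => (innerSLFlip ℂ v).comp (inclPlus m)
      map_add' := fun v w => by ext x; simp
      map_smul' := fun c v => by ext x; simp }
    1 fun v => by
      refine ContinuousLinearMap.opNorm_le_bound _ (by positivity) fun x => ?_
      change ‖inner ℂ (inclPlus m x) v‖ ≤ _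
      calc ‖inner ℂ (inclPlus m x) v‖ ≤ ‖inclPlus m x‖ * ‖v‖ := norm_inner_le_norm (𝕜 := ℂ) (inclPlus m x) v
        _ ≤ ‖x‖ * ‖v‖ := by gcongr; exact norm_toFock_le m x
        _ = 1 * ‖v‖ * ‖x‖ := by ring

theorem inclMinus_apply (m : ℝ) (v : Fock) (w : FPlus m) :
    inclMinus m v w = inner ℂ (inclPlus m w) v := rfl

/-- The annihilation operator `a(k)` at momentum `k`, acting on sequences of functions:
`(a(k) f)ₙ (p₁, …, pₙ) = (n + 1)^{1/2} fₙ₊₁ (k, p₁, …, pₙ)`. -/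
def annih (k : ℝ) (f : (n : ℕ) → (Fin n → ℝ) → ℂ) : (n : ℕ) → (Fin n → ℝ) → ℂ :=
  fun n p => (Real.sqrt (n + 1) : ℂ) * f (n + 1) (Fin.cons k p)

/-- The product `a(q₁) ⋯ a(qᵣ)` of annihilation operators. -/
def annihProd : (r : ℕ) → (Fin r → ℝ) → ((n : ℕ) → (Fin n → ℝ) → ℂ) →
    (n : ℕ) → (Fin n → ℝ) → ℂ
  | 0, _, f => f
  | r + 1, q, f => annih (q 0) (annihProd r (Fin.tail q) f)

/-- The integrand of the `n`-particle contribution to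
`∫ w(k, l) ⟨a(k₁) ⋯ a(kᵣ) φ, a(l₁) ⋯ a(lₛ) ψ⟩ dk dl`,
as a function of `k`, `l` and the momenta `p` of the `n` spectator particles. -/
def wickIntegrand {r s : ℕ} (w : (Fin r → ℝ) → (Fin s → ℝ) → ℂ) (φ ψ : Fock) (n : ℕ)
    (z : (Fin r → ℝ) × (Fin s → ℝ) × (Fin n → ℝ)) : ℂ :=
  w z.1 z.2.1 * (conj (annihProd r z.1 (component φ) n z.2.2) *
    annihProd s z.2.1 (component ψ) n z.2.2)

/-- The Wick monomial `∫ w(k, l) a*(k₁) ⋯ a*(kᵣ) a(l₁) ⋯ a(lₛ) dk dl`, as a sesquilinear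
form: its value `⟨φ, ⋯ ψ⟩`. -/
def wickForm {r s : ℕ} (w : (Fin r → ℝ) → (Fin s → ℝ) → ℂ) (φ ψ : Fock) : ℂ :=
  ∑' n : ℕ, ∫ z, wickIntegrand w φ ψ n z

/-- The sums and integrals that define `wickForm w φ ψ` converge absolutely. -/
def WickConverges {r s : ℕ} (w : (Fin r → ℝ) → (Fin s → ℝ) → ℂ) (φ ψ : Fock) : Prop :=
  (∀ n : ℕ, Integrable (wickIntegrand w φ ψ n) volume) ∧
    Summable fun n : ℕ => ∫ z, ‖wickIntegrand w φ ψ n z‖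

/-- The Fourier transform `∫ e^{-iqx} g(x, t) dx` of `g` in the space variable. -/
def spaceFourier (g : ℝ × ℝ → ℝ) (t q : ℝ) : ℂ :=
  ∫ x : ℝ, Complex.exp (-(Complex.I * q * x)) * (g (x, t) : ℂ)

/-- The kernel, as a function of `k` and `l`, of the term with `r` creation and `s` annihilation
operators of the Wick polynomial `∫ g(x, t) :φ⁴(x): dx`, for the free field
`φ(x) = (4π)^{-1/2} ∫ e^{-ikx} (a*(k) + a(-k)) ω(k)^{-1/2} dk`; the annihilated momenta are
written as `l = -k`. -/
def phi4Kernel (m : ℝ) (g : ℝ × ℝ → ℝ) (t : ℝ) (r s : ℕ) (k : Fin r → ℝ) (l : Fin s → ℝ) : ℂ :=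
  (((4 * Real.pi) ^ 2)⁻¹ : ℝ) * spaceFourier g t ((∑ i, k i) - ∑ i, l i) *
    (((∏ i, (omega m (k i)) ^ (-(1 / 2) : ℝ)) * ∏ i, (omega m (l i)) ^ (-(1 / 2) : ℝ) : ℝ) : ℂ)

/-- The interaction `V_g(t) = ∫ g(x, t) :φ⁴(x): dx` as a sesquilinear form, that is
`∑ⱼ (4 choose j) ∫ a*(k₁) ⋯ a*(kⱼ) a(-kⱼ₊₁) ⋯ a(-k₄) (⋯) dk`. -/
def interactionForm (m : ℝ) (g : ℝ × ℝ → ℝ) (t : ℝ) (φ ψ : Fock) : ℂ :=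
  ∑ j ∈ Finset.range 5, (Nat.choose 4 j : ℂ) * wickForm (phi4Kernel m g t j (4 - j)) φ ψ

end PhiFour

end

noncomputable section

namespace PhiFour

open scoped ENNReal

/-! ### A Cauchy–Schwarz inequality for three functions on a triangle of variables -/

/-! The time dependence sits entirely in the kernels of the five Wick monomials, so the theorem
splits into a bound on the operator by the `L²` norm of its kernel and smoothness of the kernels in
`L²`.

Operator bound. On a fixed particle number a product of annihilation operators is a relabelling of
variables times a factor of order `n^{r/2}`. Cauchy–Schwarz over the kernel variables and the
spectators bounds a quartic monomial by `16 ‖W‖ ∑ₙ (n+1)² ‖φₙ₊ᵣ‖ ‖ψₙ₊ₛ‖`. Since `m > 0`, the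
particle number is at most `H₀ / m`, and each side absorbs one factor `n+1` into `H₀ + 1`. Hence
`wickCLM`: kernel to operator is a bounded linear map. If `ψ ∈ D(H₀²)`, both factors can be put on
`ψ`; the functional is then bounded in the norm of `ℱ`, and Riesz makes it a vector
(`exists_eq_inclMinus`).

Kernels. Let `q` be the difference of created and annihilated total momenta. One integration by
parts in `x` bounds the Fourier transform by a constant times `(1+|q|)⁻¹`, and with the weights
`ω^{-1/2}` this is already square integrable (`memLp_profileKernel_inv`). The same argument for the
Taylor remainder of `g` in `t` gives an `L²` error `O(h²)`, so the kernel of `∂ₜg` is the derivative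
of the kernel of `g`. As `∂ₜg` is again a test function, induction gives all derivatives. -/

theorem lintegral_mul_le_two {α : Type*} [MeasurableSpace α] (μ : Measure α) {f g : α → ℝ≥0∞}
    (hf : Measurable f) (hg : Measurable g) :
    ∫⁻ x, f x * g x ∂μ ≤
      (∫⁻ x, f x ^ (2 : ℝ) ∂μ) ^ (1 / 2 : ℝ) * (∫⁻ x, g x ^ (2 : ℝ) ∂μ) ^ (1 / 2 : ℝ) :=
  ENNReal.lintegral_mul_le_Lp_mul_Lq μ Real.HolderConjugate.two_two hf.aemeasurable
    hg.aemeasurable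

theorem sqrt_rpow_two (a : ℝ≥0∞) : (a ^ (1 / 2 : ℝ)) ^ (2 : ℝ) = a := by
  rw [← ENNReal.rpow_mul]; norm_num

/-- Cauchy–Schwarz twice: in the variable shared by `a` and `b` with the other two fixed, which
leaves `A x * B y`, and then on the product space against `w`. -/
theorem lintegral_triangle_le {α β γ : Type*} [MeasurableSpace α] [MeasurableSpace β]
    [MeasurableSpace γ] (μ : Measure α) (ν : Measure β) (ρ : Measure γ) [SFinite μ] [SFinite ν]
    [SFinite ρ] {w : α × β → ℝ≥0∞} {a : α × γ → ℝ≥0∞} {b : β × γ → ℝ≥0∞}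
    (hw : Measurable w) (ha : Measurable a) (hb : Measurable b) :
    ∫⁻ z, w (z.1, z.2.1) * (a (z.1, z.2.2) * b (z.2.1, z.2.2)) ∂(μ.prod (ν.prod ρ)) ≤
      (∫⁻ z, w z ^ (2 : ℝ) ∂(μ.prod ν)) ^ (1 / 2 : ℝ) *
        ((∫⁻ z, a z ^ (2 : ℝ) ∂(μ.prod ρ)) ^ (1 / 2 : ℝ) *
          (∫⁻ z, b z ^ (2 : ℝ) ∂(ν.prod ρ)) ^ (1 / 2 : ℝ)) := by
  set A : α → ℝ≥0∞ := fun x => (∫⁻ p, a (x, p) ^ (2 : ℝ) ∂ρ) ^ (1 / 2 : ℝ) with hA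
  set B : β → ℝ≥0∞ := fun y => (∫⁻ p, b (y, p) ^ (2 : ℝ) ∂ρ) ^ (1 / 2 : ℝ) with hB
  have hAm : Measurable A := ((ha.pow_const _).lintegral_prod_right').pow_const _
  have hBm : Measurable B := ((hb.pow_const _).lintegral_prod_right').pow_const _
  have hmeas : Measurable fun z : α × β × γ =>
      w (z.1, z.2.1) * (a (z.1, z.2.2) * b (z.2.1, z.2.2)) := by fun_prop
  have hA2 : ∫⁻ x, A x ^ (2 : ℝ) ∂μ = ∫⁻ z, a z ^ (2 : ℝ) ∂(μ.prod ρ) := by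
    rw [lintegral_prod _ (ha.pow_const _).aemeasurable]
    simp only [hA, sqrt_rpow_two]
  have hB2 : ∫⁻ y, B y ^ (2 : ℝ) ∂ν = ∫⁻ z, b z ^ (2 : ℝ) ∂(ν.prod ρ) := by
    rw [lintegral_prod _ (hb.pow_const _).aemeasurable]
    simp only [hB, sqrt_rpow_two]
  have hmA : Measurable fun z : α × β => A z.1 * B z.2 := by fun_prop
  calc ∫⁻ z, w (z.1, z.2.1) * (a (z.1, z.2.2) * b (z.2.1, z.2.2)) ∂(μ.prod (ν.prod ρ))
      = ∫⁻ x, ∫⁻ y, ∫⁻ p, w (x, y) * (a (x, p) * b (y, p)) ∂ρ ∂ν ∂μ := by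
        rw [lintegral_prod _ hmeas.aemeasurable]
        refine lintegral_congr fun x => ?_
        rw [lintegral_prod _ (by fun_prop)]
    _ ≤ ∫⁻ x, ∫⁻ y, w (x, y) * (A x * B y) ∂ν ∂μ := by
        refine lintegral_mono fun x => lintegral_mono fun y => ?_
        rw [lintegral_const_mul _ (by fun_prop)]
        gcongr
        exact lintegral_mul_le_two ρ (by fun_prop) (by fun_prop)
    _ = ∫⁻ z, w z * (A z.1 * B z.2) ∂(μ.prod ν) := by
        exact (lintegral_prod (fun z => w z * (A z.1 * B z.2)) (hw.mul hmA).aemeasurable).symm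
    _ ≤ _ := by
        refine (lintegral_mul_le_two (μ.prod ν) hw hmA).trans ?_
        gcongr
        simp only [ENNReal.mul_rpow_of_nonneg _ _ (zero_le_two (α := ℝ))]
        rw [lintegral_prod_mul (hAm.pow_const _).aemeasurable (hBm.pow_const _).aemeasurable,
          hA2, hB2, ENNReal.mul_rpow_of_nonneg _ _ (by norm_num)]

theorem eLpNorm_two_eq {α E : Type*} [MeasurableSpace α] [NormedAddCommGroup E] (μ : Measure α)
    (f : α → E) : eLpNorm f 2 μ = (∫⁻ x, ‖f x‖ₑ ^ (2 : ℝ) ∂μ) ^ (1 / 2 : ℝ) := by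
  rw [eLpNorm_eq_lintegral_rpow_enorm_toReal (by norm_num) (by norm_num)]
  simp

/-! ### Products of annihilation operators -/

/-- Moving the first coordinate of the first block to the front of the second block. -/
def shiftVar (r n : ℕ) (z : (Fin (r + 1) → ℝ) × (Fin n → ℝ)) :
    (Fin r → ℝ) × (Fin (n + 1) → ℝ) :=
  (Fin.tail z.1, Fin.cons (z.1 0) z.2)

theorem measurePreserving_cons (n : ℕ) :
    MeasurePreserving (fun z : ℝ × (Fin n → ℝ) => (Fin.cons z.1 z.2 : Fin (n + 1) → ℝ))
      volume volume := by
  have h := (volume_preserving_piFinSuccAbove (fun _ : Fin (n + 1) => ℝ) 0).symm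
  have e : (fun z : ℝ × (Fin n → ℝ) => (Fin.cons z.1 z.2 : Fin (n + 1) → ℝ)) =
      (MeasurableEquiv.piFinSuccAbove (fun _ : Fin (n + 1) => ℝ) 0).symm := by
    funext z
    simp [MeasurableEquiv.piFinSuccAbove, Fin.insertNthEquiv]
  rw [e]
  exact h

theorem measurePreserving_uncons (n : ℕ) :
    MeasurePreserving (fun z : Fin (n + 1) → ℝ => (z 0, Fin.tail z)) volume volume :=
  volume_preserving_piFinSuccAbove (fun _ : Fin (n + 1) => ℝ) 0

theorem measurePreserving_shiftVar (r n : ℕ) :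
    MeasurePreserving (shiftVar r n) volume volume := by
  have h1 := (measurePreserving_uncons r).prod (MeasurePreserving.id (volume : Measure (Fin n → ℝ)))
  have h2 := (Measure.measurePreserving_swap (μ := (volume : Measure ℝ))
    (ν := (volume : Measure (Fin r → ℝ)))).prod
      (MeasurePreserving.id (volume : Measure (Fin n → ℝ)))
  have h3 := measurePreserving_prodAssoc (volume : Measure (Fin r → ℝ)) (volume : Measure ℝ)
    (volume : Measure (Fin n → ℝ))
  have h4 := (MeasurePreserving.id (volume : Measure (Fin r → ℝ))).prod (measurePreserving_cons n)
  exact h4.comp (h3.comp (h2.comp h1))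

/-- Each annihilation operator moves one variable into the argument of `f` and contributes a square
root of at most `√N`. The equation `N = n + r` is a hypothesis so that the induction needs no
transport between the types `Fin (n + 1 + r)` and `Fin (n + (r + 1))`. -/
theorem exists_annihProd_eq (r : ℕ) : ∀ n N : ℕ, N = n + r →
    ∃ (e : (Fin r → ℝ) × (Fin n → ℝ) → (Fin N → ℝ)) (c : ℝ),
      MeasurePreserving e volume volume ∧ 0 ≤ c ∧ c ≤ Real.sqrt N ^ r ∧
      ∀ f q p, annihProd r q f n p = (c : ℂ) * f N (e (q, p)) := by
  induction r with
  | zero =>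
    rintro n N rfl
    refine ⟨Prod.snd, 1, ?_, zero_le_one, by simp, fun f q p => by simp [annihProd]⟩
    -- Forgetting the empty block preserves measure because `Fin 0 → ℝ` is a point of mass one.
    have : IsProbabilityMeasure (volume : Measure (Fin 0 → ℝ)) := ⟨by simp [volume_pi]⟩
    exact measurePreserving_snd
  | succ r ih =>
    intro n N hN
    obtain ⟨e, c, he, hc0, hc, h⟩ := ih (n + 1) N (by omega)
    refine ⟨e ∘ shiftVar r n, Real.sqrt (n + 1) * c, he.comp (measurePreserving_shiftVar r n),
      by positivity, ?_, fun f q p => ?_⟩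
    · rw [pow_succ']
      gcongr
      subst hN
      push_cast
      linarith [(Nat.cast_nonneg r : (0 : ℝ) ≤ r)]
    · simp only [annihProd, annih, h]
      simp only [Function.comp, shiftVar]
      push_cast
      ring

/-- The function `(q, p) ↦ (a(q₁) ⋯ a(qᵣ) φ)ₙ(p)`. -/
def annihFun (r : ℕ) (φ : Fock) (n : ℕ) (z : (Fin r → ℝ) × (Fin n → ℝ)) : ℂ :=
  annihProd r z.1 (component φ) n z.2

theorem measurable_component (φ : Fock) (n : ℕ) : Measurable (component φ n) :=
  (Lp.stronglyMeasurable _).measurable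

theorem measurable_annihFun (r : ℕ) (φ : Fock) (n : ℕ) : Measurable (annihFun r φ n) := by
  obtain ⟨e, c, he, -, -, h⟩ := exists_annihProd_eq r n _ rfl
  have : annihFun r φ n = fun z => (c : ℂ) * component φ (n + r) (e z) := by
    funext z; exact h _ _ _
  rw [this]
  exact ((measurable_component φ _).comp he.measurable).const_mul _

theorem eLpNorm_annihFun_le (r : ℕ) (φ : Fock) (n : ℕ) :
    eLpNorm (annihFun r φ n) 2 volume ≤
      ENNReal.ofReal (Real.sqrt (n + r) ^ r * ‖(φ : FullFock) (n + r)‖) := by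
  obtain ⟨e, c, he, hc0, hc, h⟩ := exists_annihProd_eq r n _ rfl
  have : annihFun r φ n = (c : ℂ) • (component φ (n + r) ∘ e) := by
    funext z; exact h _ _ _
  rw [this, eLpNorm_const_smul,
    eLpNorm_comp_measurePreserving (measurable_component φ _).aestronglyMeasurable he,
    ENNReal.ofReal_mul (by positivity), ofReal_norm, Lp.enorm_def]
  push_cast at hc
  refine mul_le_mul' ?_ le_rfl
  rw [← ofReal_norm, Complex.norm_real, Real.norm_eq_abs, abs_of_nonneg hc0]
  exact ENNReal.ofReal_le_ofReal hc

/-- Annihilation evaluates representatives pointwise; almost everywhere identities survive because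
the relabelling `e` is measure preserving. -/
theorem annihFun_congr_ae {r n : ℕ} (φ₁ φ₂ φ₃ : Fock) (a b : ℂ)
    (h : component φ₁ (n + r) =ᵐ[volume]
      fun k => a * component φ₂ (n + r) k + b * component φ₃ (n + r) k) :
    annihFun r φ₁ n =ᵐ[volume] fun z => a * annihFun r φ₂ n z + b * annihFun r φ₃ n z := by
  obtain ⟨e, c, he, -, -, h'⟩ := exists_annihProd_eq r n _ rfl
  filter_upwards [he.quasiMeasurePreserving.ae h] with z hz
  simp only [annihFun, h', hz]
  ring

theorem component_lincomb (φ₂ φ₃ : Fock) (a b : ℂ) (n : ℕ) :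
    component (a • φ₂ + b • φ₃) n =ᵐ[volume]
      fun k => a * component φ₂ n k + b * component φ₃ n k := by
  have h2 : component (a • φ₂) n =ᵐ[volume] a • component φ₂ n :=
    Lp.coeFn_smul a ((φ₂ : FullFock) n)
  have h3 : component (b • φ₃) n =ᵐ[volume] b • component φ₃ n :=
    Lp.coeFn_smul b ((φ₃ : FullFock) n)
  filter_upwards [component_add (a • φ₂) (b • φ₃) n, h2, h3] with k h hk2 hk3
  rw [h, Pi.add_apply, hk2, hk3]
  rfl

theorem annihFun_lincomb (r n : ℕ) (φ₂ φ₃ : Fock) (a b : ℂ) :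
    annihFun r (a • φ₂ + b • φ₃) n =ᵐ[volume]
      fun z => a * annihFun r φ₂ n z + b * annihFun r φ₃ n z :=
  annihFun_congr_ae _ _ _ _ _ (component_lincomb _ _ _ _ _)

end PhiFour

namespace PhiFour

open scoped ENNReal

/-! ### Wick monomials with square integrable kernels -/

/-- The Hilbert space of square integrable kernels. -/
abbrev KernelL2 (r s : ℕ) : Type :=
  Lp ℂ 2 (volume : Measure ((Fin r → ℝ) × (Fin s → ℝ)))

/-- A square integrable kernel as a function of two groups of variables. -/
def kernelFun {r s : ℕ} (W : KernelL2 r s) (k : Fin r → ℝ) (l : Fin s → ℝ) : ℂ := W (k, l)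

section Estimates

variable {r s : ℕ}

theorem wickIntegrand_eq (w : (Fin r → ℝ) → (Fin s → ℝ) → ℂ) (φ ψ : Fock) (n : ℕ)
    (z : (Fin r → ℝ) × (Fin s → ℝ) × (Fin n → ℝ)) :
    wickIntegrand w φ ψ n z =
      w z.1 z.2.1 * (conj (annihFun r φ n (z.1, z.2.2)) * annihFun s ψ n (z.2.1, z.2.2)) := rfl

/-- Pulls null sets back to the full set of variables. The forgotten block may have infinite
measure, so only quasi-preservation is available. -/
theorem quasiMeasurePreserving_fst_snd (r s n : ℕ) :
    Measure.QuasiMeasurePreserving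
      (fun z : (Fin r → ℝ) × (Fin s → ℝ) × (Fin n → ℝ) => (z.1, z.2.2)) volume volume :=
  QuasiMeasurePreserving.prodMap
    (Measure.QuasiMeasurePreserving.id (volume : Measure (Fin r → ℝ)))
    (Measure.quasiMeasurePreserving_snd (μ := (volume : Measure (Fin s → ℝ)))
      (ν := (volume : Measure (Fin n → ℝ))))

theorem quasiMeasurePreserving_fst_fst (r s n : ℕ) :
    Measure.QuasiMeasurePreserving
      (fun z : (Fin r → ℝ) × (Fin s → ℝ) × (Fin n → ℝ) => (z.1, z.2.1)) volume volume :=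
  QuasiMeasurePreserving.prodMap
    (Measure.QuasiMeasurePreserving.id (volume : Measure (Fin r → ℝ)))
    (Measure.quasiMeasurePreserving_fst (μ := (volume : Measure (Fin s → ℝ)))
      (ν := (volume : Measure (Fin n → ℝ))))

theorem quasiMeasurePreserving_snd_snd (r s n : ℕ) :
    Measure.QuasiMeasurePreserving
      (fun z : (Fin r → ℝ) × (Fin s → ℝ) × (Fin n → ℝ) => (z.2.1, z.2.2)) volume volume :=
  Measure.quasiMeasurePreserving_snd

theorem measurable_wickIntegrand (W : KernelL2 r s) (φ ψ : Fock) (n : ℕ) :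
    Measurable (wickIntegrand (kernelFun W) φ ψ n) := by
  have h1 : Measurable fun z : (Fin r → ℝ) × (Fin s → ℝ) × (Fin n → ℝ) => W (z.1, z.2.1) :=
    (Lp.stronglyMeasurable W).measurable.comp (quasiMeasurePreserving_fst_fst r s n).measurable
  have h2 := (measurable_annihFun r φ n).comp (quasiMeasurePreserving_fst_snd r s n).measurable
  have h3 := (measurable_annihFun s ψ n).comp (quasiMeasurePreserving_snd_snd r s n).measurable
  exact h1.mul ((Complex.continuous_conj.measurable.comp h2).mul h3)

theorem lintegral_wickIntegrand_le (W : KernelL2 r s) (φ ψ : Fock) (n : ℕ) :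
    ∫⁻ z, ‖wickIntegrand (kernelFun W) φ ψ n z‖ₑ ≤
      eLpNorm W 2 volume *
        (eLpNorm (annihFun r φ n) 2 volume * eLpNorm (annihFun s ψ n) 2 volume) := by
  simp only [eLpNorm_two_eq]
  refine le_trans (le_of_eq ?_) (lintegral_triangle_le (volume : Measure (Fin r → ℝ))
    (volume : Measure (Fin s → ℝ)) (volume : Measure (Fin n → ℝ))
    (Lp.stronglyMeasurable W).measurable.enorm (measurable_annihFun r φ n).enorm
    (measurable_annihFun s ψ n).enorm)
  refine lintegral_congr fun z => ?_
  rw [wickIntegrand_eq, enorm_mul, enorm_mul, RCLike.enorm_conj]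
  rfl

/-- Degree four costs two powers of the particle number, which is what one power of `H₀ + 1` on each
side can pay for. -/
theorem sqrt_pow_mul_sqrt_pow_le (hrs : r + s = 4) (n : ℕ) :
    Real.sqrt (n + r) ^ r * Real.sqrt (n + s) ^ s ≤ 16 * ((n : ℝ) + 1) ^ 2 := by
  have hr : (r : ℝ) ≤ 4 := by exact_mod_cast (by omega : r ≤ 4)
  have hs : (s : ℝ) ≤ 4 := by exact_mod_cast (by omega : s ≤ 4)
  have hn : (0 : ℝ) ≤ n := Nat.cast_nonneg n
  calc Real.sqrt (n + r) ^ r * Real.sqrt (n + s) ^ s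
      ≤ Real.sqrt (n + 4) ^ r * Real.sqrt (n + 4) ^ s := by gcongr
    _ = (Real.sqrt (n + 4) ^ 2) ^ 2 := by rw [← pow_add, hrs, ← pow_mul]
    _ = ((n : ℝ) + 4) ^ 2 := by rw [Real.sq_sqrt (by positivity)]
    _ ≤ (4 * ((n : ℝ) + 1)) ^ 2 := by gcongr; linarith
    _ = _ := by ring

theorem lintegral_wickIntegrand_le_ofReal (hrs : r + s = 4) (W : KernelL2 r s) (φ ψ : Fock)
    (n : ℕ) :
    ∫⁻ z, ‖wickIntegrand (kernelFun W) φ ψ n z‖ₑ ≤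
      ENNReal.ofReal (16 * ‖W‖ *
        (((n : ℝ) + 1) ^ 2 * (‖(φ : FullFock) (n + r)‖ * ‖(ψ : FullFock) (n + s)‖))) := by
  refine (lintegral_wickIntegrand_le W φ ψ n).trans ?_
  rw [← Lp.enorm_def, ← ofReal_norm]
  calc _ ≤ ENNReal.ofReal ‖W‖ *
        (ENNReal.ofReal (Real.sqrt (n + r) ^ r * ‖(φ : FullFock) (n + r)‖) *
          ENNReal.ofReal (Real.sqrt (n + s) ^ s * ‖(ψ : FullFock) (n + s)‖)) := by
        gcongr
        · exact eLpNorm_annihFun_le r φ n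
        · exact eLpNorm_annihFun_le s ψ n
    _ = ENNReal.ofReal (‖W‖ * ((Real.sqrt (n + r) ^ r * Real.sqrt (n + s) ^ s) *
          (‖(φ : FullFock) (n + r)‖ * ‖(ψ : FullFock) (n + s)‖))) := by
        rw [← ENNReal.ofReal_mul (by positivity), ← ENNReal.ofReal_mul (by positivity)]
        congr 1
        ring
    _ ≤ _ := by
        refine ENNReal.ofReal_le_ofReal ?_
        calc _ ≤ ‖W‖ * ((16 * ((n : ℝ) + 1) ^ 2) *
              (‖(φ : FullFock) (n + r)‖ * ‖(ψ : FullFock) (n + s)‖)) := by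
              refine mul_le_mul_of_nonneg_left ?_ (norm_nonneg _)
              exact mul_le_mul_of_nonneg_right (sqrt_pow_mul_sqrt_pow_le hrs n) (by positivity)
          _ = _ := by ring

theorem integrable_wickIntegrand (hrs : r + s = 4) (W : KernelL2 r s) (φ ψ : Fock) (n : ℕ) :
    Integrable (wickIntegrand (kernelFun W) φ ψ n) volume :=
  ⟨(measurable_wickIntegrand W φ ψ n).aestronglyMeasurable,
    (lintegral_wickIntegrand_le_ofReal hrs W φ ψ n).trans_lt ENNReal.ofReal_lt_top⟩

theorem integral_norm_wickIntegrand_le (hrs : r + s = 4) (W : KernelL2 r s) (φ ψ : Fock)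
    (n : ℕ) :
    ∫ z, ‖wickIntegrand (kernelFun W) φ ψ n z‖ ≤ 16 * ‖W‖ *
        (((n : ℝ) + 1) ^ 2 * (‖(φ : FullFock) (n + r)‖ * ‖(ψ : FullFock) (n + s)‖)) := by
  rw [integral_norm_eq_lintegral_enorm (measurable_wickIntegrand W φ ψ n).aestronglyMeasurable]
  exact ENNReal.toReal_le_of_le_ofReal (by positivity)
    (lintegral_wickIntegrand_le_ofReal hrs W φ ψ n)

/-- Cauchy–Schwarz in `ℓ²`; a shift of the index only drops terms of the norm. -/
theorem summable_shift_mul (χ ξ : FullFock) (r s : ℕ) :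
    (Summable fun n => ‖χ (n + r)‖ * ‖ξ (n + s)‖) ∧
      ∑' n, ‖χ (n + r)‖ * ‖ξ (n + s)‖ ≤ ‖χ‖ * ‖ξ‖ := by
  have key : ∀ (χ : FullFock) (r : ℕ), (Summable fun n => ‖χ (n + r)‖ ^ (2 : ℝ)) ∧
      (∑' n, ‖χ (n + r)‖ ^ (2 : ℝ)) ^ (1 / 2 : ℝ) ≤ ‖χ‖ := by
    intro χ r
    have h := lp.hasSum_norm (p := 2) (by norm_num) χ
    simp only [ENNReal.toReal_ofNat] at h
    have hinj : Function.Injective fun n : ℕ => n + r := add_left_injective r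
    refine ⟨h.summable.comp_injective hinj, ?_⟩
    have hle : ∑' n, ‖χ (n + r)‖ ^ (2 : ℝ) ≤ ‖χ‖ ^ (2 : ℝ) := by
      rw [← h.tsum_eq]
      exact (h.summable.comp_injective hinj).tsum_le_tsum_of_inj _ hinj
        (fun _ _ => by positivity) (fun _ => le_rfl) h.summable
    calc _ ≤ (‖χ‖ ^ (2 : ℝ)) ^ (1 / 2 : ℝ) :=
          Real.rpow_le_rpow (tsum_nonneg fun _ => by positivity) hle (by norm_num)
      _ = ‖χ‖ := by rw [← Real.rpow_mul (norm_nonneg _)]; norm_num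
  obtain ⟨h1, h2⟩ := Real.summable_and_inner_le_Lp_mul_Lq_tsum_of_nonneg
    Real.HolderConjugate.two_two (fun n => norm_nonneg (χ (n + r)))
    (fun n => norm_nonneg (ξ (n + s))) (key χ r).1 (key ξ s).1
  refine ⟨h1, h2.trans ?_⟩
  gcongr
  · exact (key χ r).2
  · exact (key ξ s).2

/-- The majorants `χ`, `ξ` are left free so that the weight `(n+1)²` can be shared by both vectors,
for bounds between `ℱ₊₂` and `ℱ₋₂`, or put wholly on `ψ`, for values in `ℱ`. -/
theorem wickConverges_and_norm_wickForm_le (hrs : r + s = 4) (W : KernelL2 r s) (φ ψ : Fock)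
    (χ ξ : FullFock) (K : ℝ) (hK : ∀ n : ℕ, ((n : ℝ) + 1) ^ 2 *
      (‖(φ : FullFock) (n + r)‖ * ‖(ψ : FullFock) (n + s)‖) ≤ K * (‖χ (n + r)‖ * ‖ξ (n + s)‖))
    (hK0 : 0 ≤ K) :
    WickConverges (kernelFun W) φ ψ ∧
      ‖wickForm (kernelFun W) φ ψ‖ ≤ 16 * K * ‖W‖ * (‖χ‖ * ‖ξ‖) := by
  obtain ⟨h1, h2⟩ := summable_shift_mul χ ξ r s
  have hle : ∀ n, ∫ z, ‖wickIntegrand (kernelFun W) φ ψ n z‖ ≤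
      16 * K * ‖W‖ * (‖χ (n + r)‖ * ‖ξ (n + s)‖) := fun n =>
    calc _ ≤ _ := integral_norm_wickIntegrand_le hrs W φ ψ n
      _ ≤ 16 * ‖W‖ * (K * (‖χ (n + r)‖ * ‖ξ (n + s)‖)) := mul_le_mul_of_nonneg_left (hK n) (by positivity)
      _ = _ := by ring
  have hsum : Summable fun n : ℕ => ∫ z, ‖wickIntegrand (kernelFun W) φ ψ n z‖ :=
    Summable.of_nonneg_of_le (fun n => integral_nonneg fun _ => norm_nonneg _) hle
      (h1.mul_left _)
  refine ⟨⟨integrable_wickIntegrand hrs W φ ψ, hsum⟩, ?_⟩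
  calc ‖wickForm (kernelFun W) φ ψ‖
      ≤ ∑' n : ℕ, 16 * K * ‖W‖ * (‖χ (n + r)‖ * ‖ξ (n + s)‖) :=
        tsum_of_norm_bounded (h1.mul_left _).hasSum fun n =>
          (norm_integral_le_integral_norm _).trans (hle n)
    _ = 16 * K * ‖W‖ * ∑' n : ℕ, ‖χ (n + r)‖ * ‖ξ (n + s)‖ := tsum_mul_left
    _ ≤ _ := by gcongr

/-! ### Linearity of the Wick form and independence of the representative of the kernel -/

theorem WickConverges.summable_integral {w : (Fin r → ℝ) → (Fin s → ℝ) → ℂ} {φ ψ : Fock}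
    (h : WickConverges w φ ψ) : Summable fun n : ℕ => ∫ z, wickIntegrand w φ ψ n z :=
  h.2.of_norm_bounded fun _ => norm_integral_le_integral_norm _

/-- A pointwise linear relation between three Wick integrands passes to the forms. -/
theorem wickForm_lincomb {w₁ w₂ w₃ : (Fin r → ℝ) → (Fin s → ℝ) → ℂ}
    {φ₁ φ₂ φ₃ ψ₁ ψ₂ ψ₃ : Fock} (a b : ℂ) (h₂ : WickConverges w₂ φ₂ ψ₂)
    (h₃ : WickConverges w₃ φ₃ ψ₃)
    (h : ∀ n, wickIntegrand w₁ φ₁ ψ₁ n =ᵐ[volume]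
      fun z => a * wickIntegrand w₂ φ₂ ψ₂ n z + b * wickIntegrand w₃ φ₃ ψ₃ n z) :
    wickForm w₁ φ₁ ψ₁ = a * wickForm w₂ φ₂ ψ₂ + b * wickForm w₃ φ₃ ψ₃ := by
  unfold wickForm
  rw [← tsum_mul_left, ← tsum_mul_left,
    ← (h₂.summable_integral.mul_left a).tsum_add (h₃.summable_integral.mul_left b)]
  refine tsum_congr fun n => ?_
  rw [integral_congr_ae (h n), integral_add ((h₂.1 n).const_mul a) ((h₃.1 n).const_mul b),
    integral_const_mul, integral_const_mul]

theorem wickForm_lincomb_left {w : (Fin r → ℝ) → (Fin s → ℝ) → ℂ} {φ₂ φ₃ ψ : Fock} (a b : ℂ)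
    (h₂ : WickConverges w φ₂ ψ) (h₃ : WickConverges w φ₃ ψ) :
    wickForm w (a • φ₂ + b • φ₃) ψ = conj a * wickForm w φ₂ ψ + conj b * wickForm w φ₃ ψ := by
  refine wickForm_lincomb _ _ h₂ h₃ fun n => ?_
  filter_upwards [(quasiMeasurePreserving_fst_snd r s n).ae (annihFun_lincomb r n φ₂ φ₃ a b)]
    with z hz
  simp only [wickIntegrand_eq, hz, map_add, map_mul]
  ring

theorem wickForm_lincomb_right {w : (Fin r → ℝ) → (Fin s → ℝ) → ℂ} {φ ψ₂ ψ₃ : Fock} (a b : ℂ)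
    (h₂ : WickConverges w φ ψ₂) (h₃ : WickConverges w φ ψ₃) :
    wickForm w φ (a • ψ₂ + b • ψ₃) = a * wickForm w φ ψ₂ + b * wickForm w φ ψ₃ := by
  refine wickForm_lincomb _ _ h₂ h₃ fun n => ?_
  filter_upwards [(quasiMeasurePreserving_snd_snd r s n).ae (annihFun_lincomb s n ψ₂ ψ₃ a b)]
    with z hz
  simp only [wickIntegrand_eq, hz]
  ring

theorem wickForm_lincomb_kernel {W₂ W₃ : KernelL2 r s} {φ ψ : Fock} (a b : ℂ)
    (h₂ : WickConverges (kernelFun W₂) φ ψ) (h₃ : WickConverges (kernelFun W₃) φ ψ) :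
    wickForm (kernelFun (a • W₂ + b • W₃)) φ ψ =
      a * wickForm (kernelFun W₂) φ ψ + b * wickForm (kernelFun W₃) φ ψ := by
  refine wickForm_lincomb _ _ h₂ h₃ fun n => ?_
  have hq := quasiMeasurePreserving_fst_fst r s n
  filter_upwards [hq.ae (Lp.coeFn_add (a • W₂) (b • W₃)), hq.ae (Lp.coeFn_smul a W₂),
    hq.ae (Lp.coeFn_smul b W₃)] with z h1 h2 h3
  simp only [wickIntegrand_eq, kernelFun, h1, Pi.add_apply, h2, h3, Pi.smul_apply, smul_eq_mul]
  ring

theorem wickIntegrand_congr_ae {w w' : (Fin r → ℝ) → (Fin s → ℝ) → ℂ}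
    (h : ∀ᵐ x : (Fin r → ℝ) × (Fin s → ℝ), w x.1 x.2 = w' x.1 x.2) (φ ψ : Fock) (n : ℕ) :
    wickIntegrand w φ ψ n =ᵐ[volume] wickIntegrand w' φ ψ n := by
  filter_upwards [(quasiMeasurePreserving_fst_fst r s n).ae h] with z hz
  simp only [wickIntegrand_eq]
  rw [hz]

theorem WickConverges.congr_ae {w w' : (Fin r → ℝ) → (Fin s → ℝ) → ℂ} {φ ψ : Fock}
    (hw : WickConverges w φ ψ) (h : ∀ᵐ x : (Fin r → ℝ) × (Fin s → ℝ), w x.1 x.2 = w' x.1 x.2) :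
    WickConverges w' φ ψ := by
  refine ⟨fun n => (hw.1 n).congr (wickIntegrand_congr_ae h φ ψ n), ?_⟩
  convert hw.2 using 2 with n
  refine integral_congr_ae ?_
  filter_upwards [wickIntegrand_congr_ae h φ ψ n] with z hz
  rw [hz]

theorem wickForm_congr_ae {w w' : (Fin r → ℝ) → (Fin s → ℝ) → ℂ}
    (h : ∀ᵐ x : (Fin r → ℝ) × (Fin s → ℝ), w x.1 x.2 = w' x.1 x.2) (φ ψ : Fock) :
    wickForm w φ ψ = wickForm w' φ ψ :=
  tsum_congr fun n => integral_congr_ae (wickIntegrand_congr_ae h φ ψ n)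

end Estimates

end PhiFour

namespace PhiFour

open scoped ENNReal

/-! ### Wick monomials as bounded operators from `ℱ₊₂` to `ℱ₋₂` -/

theorem le_omega (m k : ℝ) : m ≤ omega m k := by
  unfold omega
  exact Real.le_sqrt_of_sq_le (by nlinarith [sq_nonneg k])

/-- Every particle has energy at least `m`, so `n + 1 ≤ (1 + m⁻¹)(n m + 1)` is dominated by `(1 +
m⁻¹)` times the multiplier of `H₀ + 1`. -/
theorem mul_norm_le_norm_shiftedH {m : ℝ} (hm : 0 < m) (x : (freeH m).domain) (n : ℕ) :
    ((n : ℝ) + 1) * ‖((x : Fock) : FullFock) n‖ ≤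
      (1 + m⁻¹) * ‖((shiftedH m x : Fock) : FullFock) n‖ := by
  have h : ∀ᵐ k, ‖component x n k‖ ≤
      ((1 + m⁻¹) / ((n : ℝ) + 1)) * ‖component (shiftedH m x) n k‖ := by
    filter_upwards [shiftedH_component m x n] with k hk
    have hE : n * m ≤ ∑ i, omega m (k i) := by
      calc n * m = ∑ _i : Fin n, m := by simp
        _ ≤ _ := Finset.sum_le_sum fun i _ => le_omega m _
    rw [hk, norm_mul, Complex.norm_real, Real.norm_eq_abs,
      abs_of_nonneg (by linarith [energy_nonneg m k]), ← mul_assoc]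
    refine le_mul_of_one_le_left (norm_nonneg _) ?_
    rw [div_mul_eq_mul_div, one_le_div (by positivity)]
    have h1 : (1 + m⁻¹) * ((n : ℝ) * m + 1) ≤ (1 + m⁻¹) * ((∑ i, omega m (k i)) + 1) := by
      gcongr
    refine le_trans ?_ h1
    have h2 : (1 + m⁻¹) * ((n : ℝ) * m + 1) = n + 1 + (n * m + m⁻¹) := by
      field_simp
      ring
    rw [h2]
    have : 0 ≤ (n : ℝ) * m + m⁻¹ := by positivity
    linarith
  have h' := Lp.norm_le_mul_norm_of_ae_le_mul (f := ((x : Fock) : FullFock) n)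
    (g := ((shiftedH m x : Fock) : FullFock) n) h
  rw [div_mul_eq_mul_div, le_div_iff₀ (by positivity)] at h'
  linarith

section Operator

variable {m : ℝ} {r s : ℕ}

/-- A vector of `ℱ₊₂` as an element of the domain of the free Hamiltonian. -/
def toDomain (φ : FPlus m) : (freeH m).domain := φ

theorem inclPlus_coe (φ : FPlus m) : inclPlus m φ = (toDomain φ : Fock) := rfl

theorem norm_eq_shiftedH (φ : FPlus m) :
    ‖φ‖ = ‖((shiftedH m (toDomain φ) : Fock) : FullFock)‖ := rfl

theorem wickConverges_of_domain (hm : 0 < m) (hrs : r + s = 4) (W : KernelL2 r s)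
    (φ ψ : FPlus m) :
    WickConverges (kernelFun W) (inclPlus m φ) (inclPlus m ψ) ∧
      ‖wickForm (kernelFun W) (inclPlus m φ) (inclPlus m ψ)‖ ≤
        16 * (1 + m⁻¹) ^ 2 * ‖W‖ * ‖ψ‖ * ‖φ‖ := by
  have h := wickConverges_and_norm_wickForm_le hrs W (inclPlus m φ) (inclPlus m ψ)
    ((shiftedH m (toDomain φ) : Fock) : FullFock) ((shiftedH m (toDomain ψ) : Fock) : FullFock)
    ((1 + m⁻¹) ^ 2) (fun n => ?_) (by positivity)
  · rw [← norm_eq_shiftedH, ← norm_eq_shiftedH] at h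
    exact ⟨h.1, h.2.trans (le_of_eq (by ring))⟩
  have h1 := mul_norm_le_norm_shiftedH hm (toDomain φ) (n + r)
  have h2 := mul_norm_le_norm_shiftedH hm (toDomain ψ) (n + s)
  have h1' : ((n : ℝ) + 1) * ‖((inclPlus m φ : Fock) : FullFock) (n + r)‖ ≤
      (1 + m⁻¹) * ‖((shiftedH m (toDomain φ) : Fock) : FullFock) (n + r)‖ := by
    refine le_trans ?_ h1
    rw [inclPlus_coe]
    gcongr
    omega
  have h2' : ((n : ℝ) + 1) * ‖((inclPlus m ψ : Fock) : FullFock) (n + s)‖ ≤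
      (1 + m⁻¹) * ‖((shiftedH m (toDomain ψ) : Fock) : FullFock) (n + s)‖ := by
    refine le_trans ?_ h2
    rw [inclPlus_coe]
    gcongr
    omega
  calc _ = (((n : ℝ) + 1) * ‖((inclPlus m φ : Fock) : FullFock) (n + r)‖) *
        (((n : ℝ) + 1) * ‖((inclPlus m ψ : Fock) : FullFock) (n + s)‖) := by ring
    _ ≤ _ := mul_le_mul h1' h2' (by positivity) (by positivity)
    _ = _ := by ring

/-- The Wick monomial with square integrable kernel `W`, as a bounded operator. -/
def wickOp (hm : 0 < m) (hrs : r + s = 4) (W : KernelL2 r s) : FPlus m →L[ℂ] FMinus m :=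
  LinearMap.mkContinuous₂
    (LinearMap.mk₂'ₛₗ (RingHom.id ℂ) (starRingEnd ℂ)
      (fun ψ φ => wickForm (kernelFun W) (inclPlus m φ) (inclPlus m ψ))
      (fun ψ₁ ψ₂ φ => by
        simpa using wickForm_lincomb_right 1 1 (wickConverges_of_domain hm hrs W φ ψ₁).1
          (wickConverges_of_domain hm hrs W φ ψ₂).1)
      (fun c ψ φ => by
        -- Homogeneity is the linear combination with second coefficient zero, so the second
        -- convergence hypothesis only fills a place.
        simpa using wickForm_lincomb_right c 0 (wickConverges_of_domain hm hrs W φ ψ).1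
          (wickConverges_of_domain hm hrs W φ ψ).1)
      (fun ψ φ₁ φ₂ => by
        simpa using wickForm_lincomb_left 1 1 (wickConverges_of_domain hm hrs W φ₁ ψ).1
          (wickConverges_of_domain hm hrs W φ₂ ψ).1)
      (fun c ψ φ => by
        simpa using wickForm_lincomb_left c 0 (wickConverges_of_domain hm hrs W φ ψ).1
          (wickConverges_of_domain hm hrs W φ ψ).1))
    (16 * (1 + m⁻¹) ^ 2 * ‖W‖) fun ψ φ => (wickConverges_of_domain hm hrs W φ ψ).2

theorem wickOp_apply (hm : 0 < m) (hrs : r + s = 4) (W : KernelL2 r s) (ψ φ : FPlus m) :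
    wickOp hm hrs W ψ φ = wickForm (kernelFun W) (inclPlus m φ) (inclPlus m ψ) := rfl

/-- The Wick monomial as a bounded linear function of its kernel. -/
def wickCLM (hm : 0 < m) (hrs : r + s = 4) :
    KernelL2 r s →L[ℂ] FPlus m →L[ℂ] FMinus m :=
  LinearMap.mkContinuous
    { toFun := wickOp hm hrs
      map_add' := fun W₁ W₂ => by
        ext ψ φ
        simpa [wickOp_apply] using wickForm_lincomb_kernel 1 1
          (wickConverges_of_domain hm hrs W₁ φ ψ).1 (wickConverges_of_domain hm hrs W₂ φ ψ).1
      map_smul' := fun c W => by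
        ext ψ φ
        simpa [wickOp_apply] using wickForm_lincomb_kernel c 0
          (wickConverges_of_domain hm hrs W φ ψ).1 (wickConverges_of_domain hm hrs W φ ψ).1 }
    (16 * (1 + m⁻¹) ^ 2) fun W =>
      ContinuousLinearMap.opNorm_le_bound₂ _ (by positivity) fun ψ φ =>
        (wickConverges_of_domain hm hrs W φ ψ).2

theorem wickCLM_apply (hm : 0 < m) (hrs : r + s = 4) (W : KernelL2 r s) (ψ φ : FPlus m) :
    wickCLM hm hrs W ψ φ = wickForm (kernelFun W) (inclPlus m φ) (inclPlus m ψ) := rfl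

/-- The free Hamiltonian as a bounded operator from `ℱ₊₂` to `ℱ`. -/
def freeHCLM (m : ℝ) : FPlus m →L[ℂ] Fock :=
  (freeHLin m).mkContinuous 1 fun x => by
    rw [one_mul]
    refine norm_fock_le fun n => ?_
    filter_upwards [shiftedH_component m x n, freeH_component m x n] with k h1 h2
    change ‖component (freeH m x) n k‖ ≤ _
    rw [h1, h2, norm_mul, norm_mul, Complex.norm_real, Complex.norm_real, Real.norm_eq_abs,
      Real.norm_eq_abs, abs_of_nonneg (energy_nonneg m k),
      abs_of_nonneg (by linarith [energy_nonneg m k])]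
    gcongr
    linarith

/-- On `D(H₀²)` the Wick monomial is bounded for the norm of Fock space in its left argument. -/
theorem exists_norm_wickForm_le (hm : 0 < m) (hrs : r + s = 4) (W : KernelL2 r s)
    (ψ : FPlus m) (hψ : inclPlus m ψ ∈ domPow m 2) :
    ∃ C, ∀ φ : FPlus m, ‖wickForm (kernelFun W) (inclPlus m φ) (inclPlus m ψ)‖ ≤
      C * ‖inclPlus m φ‖ := by
  obtain ⟨h1, h2, -⟩ := hψ
  have h3 : (shiftedH m (toDomain ψ) : Fock) ∈ (freeH m).domain :=
    (freeH m).domain.add_mem h2 h1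
  -- With `χ = (H₀ + 1)ψ` again in the domain, the number bound applies twice, to `ψ` and to `χ`,
  -- and nothing is asked of `φ` beyond its Fock norm.
  set χ : (freeH m).domain := ⟨shiftedH m (toDomain ψ), h3⟩ with hχ
  refine ⟨16 * (1 + m⁻¹) ^ 2 * ‖W‖ * ‖((shiftedH m χ : Fock) : FullFock)‖, fun φ => ?_⟩
  have h := wickConverges_and_norm_wickForm_le hrs W (inclPlus m φ) (inclPlus m ψ)
    ((inclPlus m φ : Fock) : FullFock) ((shiftedH m χ : Fock) : FullFock)
    ((1 + m⁻¹) ^ 2) (fun n => ?_) (by positivity)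
  · refine h.2.trans (le_of_eq ?_)
    rw [Submodule.coe_norm]
    ring
  have e1 := mul_norm_le_norm_shiftedH hm (toDomain ψ) (n + s)
  have e2 := mul_norm_le_norm_shiftedH hm χ (n + s)
  have hns : (n : ℝ) + 1 ≤ ((n + s : ℕ) : ℝ) + 1 := by
    push_cast
    linarith [(Nat.cast_nonneg s : (0 : ℝ) ≤ s)]
  have e3 : ((n : ℝ) + 1) ^ 2 * ‖((inclPlus m ψ : Fock) : FullFock) (n + s)‖ ≤
      (1 + m⁻¹) ^ 2 * ‖((shiftedH m χ : Fock) : FullFock) (n + s)‖ := by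
    calc _ ≤ (((n + s : ℕ) : ℝ) + 1) ^ 2 * ‖((inclPlus m ψ : Fock) : FullFock) (n + s)‖ := by
          gcongr
      _ = (((n + s : ℕ) : ℝ) + 1) *
          ((((n + s : ℕ) : ℝ) + 1) * ‖((toDomain ψ : Fock) : FullFock) (n + s)‖) := by
          rw [inclPlus_coe]; ring
      _ ≤ (((n + s : ℕ) : ℝ) + 1) * ((1 + m⁻¹) * ‖((χ : Fock) : FullFock) (n + s)‖) := by
          gcongr
      _ = (1 + m⁻¹) * ((((n + s : ℕ) : ℝ) + 1) * ‖((χ : Fock) : FullFock) (n + s)‖) := by ring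
      _ ≤ (1 + m⁻¹) * ((1 + m⁻¹) * ‖((shiftedH m χ : Fock) : FullFock) (n + s)‖) := by
          gcongr
      _ = _ := by ring
  calc _ = ‖((inclPlus m φ : Fock) : FullFock) (n + r)‖ *
        (((n : ℝ) + 1) ^ 2 * ‖((inclPlus m ψ : Fock) : FullFock) (n + s)‖) := by ring
    _ ≤ _ := mul_le_mul_of_nonneg_left e3 (norm_nonneg _)
    _ = _ := by ring

end Operator

/-! ### Bounded functionals are represented by Fock space vectors -/

/-- Symmetry is a family of fixed-point equations for isometries of `L²`, hence closed. This gives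
the completeness of `ℱ` that Riesz representation requires. -/
theorem isClosed_symmetricPart : IsClosed (symmetricPart : Set FullFock) := by
  have hσ : ∀ (n : ℕ) (σ : Equiv.Perm (Fin n)),
      MeasurePreserving (fun k : Fin n → ℝ => k ∘ σ) volume volume := by
    intro n σ
    have h := volume_measurePreserving_piCongrLeft (fun _ : Fin n => ℝ) σ.symm
    have e : (MeasurableEquiv.piCongrLeft (fun _ : Fin n => ℝ) σ.symm : (Fin n → ℝ) → Fin n → ℝ)
        = fun k => k ∘ σ := by
      funext k i
      simpa using
        MeasurableEquiv.piCongrLeft_apply_apply (β := fun _ : Fin n => ℝ) σ.symm k (σ i)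
    rwa [e] at h
  have heq : (symmetricPart : Set FullFock) = ⋂ (n : ℕ) (σ : Equiv.Perm (Fin n)),
      {ψ : FullFock | Lp.compMeasurePreserving _ (hσ n σ) (ψ n) = ψ n} := by
    ext ψ
    simp only [Set.mem_iInter, Set.mem_ofPred_eq]
    refine forall₂_congr fun n σ => ?_
    rw [Lp.ext_iff]
    have h := Lp.coeFn_compMeasurePreserving (ψ n) (hσ n σ)
    exact ⟨fun h' => h.trans h', fun h' => h.symm.trans h'⟩
  rw [heq]
  refine isClosed_iInter fun n => isClosed_iInter fun σ => ?_
  have hc : Continuous fun ψ : FullFock => ψ n :=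
    (lp.evalCLM ℂ Sector 2 n).continuous
  exact isClosed_eq ((Lp.isometry_compMeasurePreserving (hσ n σ)).continuous.comp hc) hc

instance : CompleteSpace Fock := isClosed_symmetricPart.completeSpace_coe

/-- The conjugate of `f` is linear and bounded for the Fock norm on `D(H₀)`; Hahn–Banach extends it
to `ℱ` and Riesz represents the extension. -/
theorem exists_eq_inclMinus {m : ℝ} (f : FMinus m) (C : ℝ)
    (hC : ∀ φ, ‖f φ‖ ≤ C * ‖inclPlus m φ‖) : ∃ η : Fock, f = inclMinus m η := by
  -- The type `(freeH m).domain` carries the norm inherited from `ℱ`, whereas `FPlus m` carries the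
  -- graph norm.
  let g : (freeH m).domain →ₗ[ℂ] ℂ :=
    { toFun := fun φ => conj (f φ)
      map_add' := fun x y => by rw [← map_add]; congr 1; exact f.map_add x y
      map_smul' := fun c x => by
        have h : f (c • x : FPlus m) = conj c * f x := f.map_smulₛₗ c x
        change conj (f (c • x : FPlus m)) = _
        rw [h]
        simp }
  obtain ⟨G, hG, -⟩ := exists_extension_norm_eq (freeH m).domain
    (g.mkContinuous C fun φ => by
      change ‖conj (f φ)‖ ≤ _
      rw [RCLike.norm_conj]
      exact hC φ)
  refine ⟨(InnerProductSpace.toDual ℂ Fock).symm G, ?_⟩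
  ext φ
  have h1 : G (inclPlus m φ) = conj (f φ) := hG (toDomain φ)
  rw [inclMinus_apply]
  refine Eq.trans ?_ (inner_conj_symm (𝕜 := ℂ) (inclPlus m φ) _)
  rw [InnerProductSpace.toDual_symm_apply, h1, Complex.conj_conj]

end PhiFour

namespace PhiFour

open scoped ENNReal

/-! ### Square integrability of the kernels -/

/-- The weight `(1 + |q|)^{-a}`, with values in the extended nonnegative reals. -/
def decay (a q : ℝ) : ℝ≥0∞ := ENNReal.ofReal ((1 + |q|) ^ (-a))

theorem decay_neg (a q : ℝ) : decay a (-q) = decay a q := by simp [decay]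

@[fun_prop]
theorem measurable_decay (a : ℝ) : Measurable (decay a) := by
  unfold decay
  fun_prop

theorem decay_mul (a b q : ℝ) : decay a q * decay b q = decay (a + b) q := by
  unfold decay
  rw [← ENNReal.ofReal_mul (by positivity), ← Real.rpow_add (by positivity), neg_add]

/-- A multiplicative form of the triangle inequality. -/
theorem decay_add_mul_decay_le {a : ℝ} (ha : 0 ≤ a) (q k : ℝ) :
    decay a (q + k) * decay a k ≤ decay a q := by
  unfold decay
  rw [← ENNReal.ofReal_mul (by positivity), ← Real.mul_rpow (by positivity) (by positivity)]
  refine ENNReal.ofReal_le_ofReal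
    (Real.rpow_le_rpow_of_nonpos (by positivity) ?_ (by linarith))
  have h : |q| ≤ |q + k| + |k| := by simpa using abs_sub (q + k) k
  nlinarith [abs_nonneg (q + k), abs_nonneg k]

/-- Both weights are at most their values at whichever of `p`, `k` has the smaller modulus. -/
theorem decay_mul_decay_le {a b : ℝ} (ha : 0 ≤ a) (hb : 0 ≤ b) (p k : ℝ) :
    decay a p * decay b k ≤ decay (a + b) p + decay (a + b) k := by
  have key : ∀ {c x y : ℝ}, 0 ≤ c → |x| ≤ |y| → decay c y ≤ decay c x := fun hc h =>
    ENNReal.ofReal_le_ofReal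
      (Real.rpow_le_rpow_of_nonpos (by positivity) (by linarith) (by linarith))
  rcases le_total |p| |k| with h | h
  · calc _ ≤ decay a p * decay b p := by gcongr; exact key hb h
      _ = decay (a + b) p := decay_mul _ _ _
      _ ≤ _ := le_self_add
  · calc _ ≤ decay a k * decay b k := by gcongr; exact key ha h
      _ = decay (a + b) k := decay_mul _ _ _
      _ ≤ _ := le_add_self

theorem lintegral_decay_lt_top {a : ℝ} (ha : 1 < a) : ∫⁻ k, decay a k < ⊤ := by
  simpa [decay, Real.norm_eq_abs] using
    finite_integral_one_add_norm (E := ℝ) (μ := volume) (r := a) (by simpa using ha)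

/-- A third of `a` is taken from each factor and yields `decay (a / 3) q` by the triangle
inequality. The remaining exponents add up to `1 + a / 3 > 1`, so their integral is finite and does
not depend on `q`. -/
theorem lintegral_decay_convolution_le {a : ℝ} (ha : 0 < a) (ha1 : a ≤ 1) :
    ∃ C : ℝ≥0∞, C ≠ ⊤ ∧ ∀ q, ∫⁻ k, decay a (q + k) * decay 1 k ≤ C * decay (a / 3) q := by
  set I := ∫⁻ k, decay (2 * a / 3 + (1 - a / 3)) k with hI
  have hI' : I < ⊤ := lintegral_decay_lt_top (by linarith)
  refine ⟨I + I, by simp [hI'.ne], fun q => ?_⟩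
  calc ∫⁻ k, decay a (q + k) * decay 1 k
      ≤ ∫⁻ k, (decay (2 * a / 3 + (1 - a / 3)) (q + k) +
          decay (2 * a / 3 + (1 - a / 3)) k) * decay (a / 3) q := by
        refine lintegral_mono fun k => ?_
        have e1 : decay a (q + k) = decay (2 * a / 3) (q + k) * decay (a / 3) (q + k) := by
          rw [decay_mul]; congr 1; ring
        have e2 : decay 1 k = decay (1 - a / 3) k * decay (a / 3) k := by
          rw [decay_mul]; congr 1; ring
        calc _ = (decay (2 * a / 3) (q + k) * decay (1 - a / 3) k) *
              (decay (a / 3) (q + k) * decay (a / 3) k) := by rw [e1, e2]; ring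
          _ ≤ _ := mul_le_mul' (decay_mul_decay_le (by linarith) (by linarith) _ _)
              (decay_add_mul_decay_le (by linarith) _ _)
    _ = (I + I) * decay (a / 3) q := by
        rw [lintegral_mul_const _ (by fun_prop), lintegral_add_left (by fun_prop),
          lintegral_add_left_eq_self (fun k => decay (2 * a / 3 + (1 - a / 3)) k) q]

/-- Each integration divides the exponent by three but leaves it positive, so any number of
variables can be integrated out. -/
theorem lintegral_decay_sum_le (n : ℕ) : ∀ {a : ℝ}, 0 < a → a ≤ 1 →
    ∃ C : ℝ≥0∞, C ≠ ⊤ ∧ ∃ b, 0 < b ∧ b ≤ 1 ∧ ∀ q,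
      ∫⁻ k : Fin n → ℝ, decay a (q + ∑ i, k i) * ∏ i, decay 1 (k i) ≤ C * decay b q := by
  induction n with
  | zero =>
    intro a ha ha1
    exact ⟨1, by simp, a, ha, ha1, fun q => by simp [volume_pi]⟩
  | succ n ih =>
    intro a ha ha1
    obtain ⟨C, hC, b, hb, hb1, h⟩ := ih ha ha1
    obtain ⟨C', hC', h'⟩ := lintegral_decay_convolution_le hb hb1
    refine ⟨C * C', ENNReal.mul_ne_top hC hC', b / 3, by positivity, by linarith, fun q => ?_⟩
    have hm : ∀ x : ℝ, Measurable fun k : Fin n → ℝ =>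
        decay a (x + ∑ i, k i) * ∏ i, decay 1 (k i) := fun x => by
      refine Measurable.mul (by fun_prop) ?_
      exact Finset.measurable_prod _ fun i _ => by fun_prop
    calc ∫⁻ k : Fin (n + 1) → ℝ, decay a (q + ∑ i, k i) * ∏ i, decay 1 (k i)
        = ∫⁻ z : ℝ × (Fin n → ℝ), decay 1 z.1 *
            (decay a ((q + z.1) + ∑ i, z.2 i) * ∏ i, decay 1 (z.2 i)) := by
          rw [← (measurePreserving_cons n).lintegral_comp (by
            refine Measurable.mul (by fun_prop) ?_
            exact Finset.measurable_prod _ fun i _ => by fun_prop)]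
          refine lintegral_congr fun z => ?_
          simp only [Fin.sum_univ_succ, Fin.prod_univ_succ, Fin.cons_zero, Fin.cons_succ]
          rw [← add_assoc]
          ring
      _ = ∫⁻ x, decay 1 x *
            ∫⁻ k : Fin n → ℝ, decay a ((q + x) + ∑ i, k i) * ∏ i, decay 1 (k i) := by
          rw [Measure.volume_eq_prod, lintegral_prod]
          · exact lintegral_congr fun x => lintegral_const_mul (decay 1 x) (hm (q + x))
          · refine Measurable.aemeasurable (Measurable.mul (by fun_prop)
              (Measurable.mul (by fun_prop) ?_))
            exact Finset.measurable_prod _ fun i _ => by fun_prop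
      _ ≤ ∫⁻ x, C * (decay b (q + x) * decay 1 x) := by
          refine lintegral_mono fun x => ?_
          calc _ ≤ decay 1 x * (C * decay b (q + x)) := by gcongr; exact h _
            _ = _ := by ring
      _ ≤ C * (C' * decay (b / 3) q) := by
          rw [lintegral_const_mul _ (by fun_prop)]
          gcongr
          exact h' q
      _ = _ := by ring

theorem lintegral_decay_sub_lt_top (r s : ℕ) :
    ∫⁻ z : (Fin r → ℝ) × (Fin s → ℝ), decay 1 ((∑ i, z.1 i) - ∑ i, z.2 i) *
      ((∏ i, decay 1 (z.1 i)) * ∏ i, decay 1 (z.2 i)) < ⊤ := by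
  obtain ⟨C, hC, b, hb, hb1, h⟩ := lintegral_decay_sum_le s one_pos le_rfl
  obtain ⟨C', hC', b', hb', -, h'⟩ := lintegral_decay_sum_le r hb hb1
  have hneg : ∀ q, ∫⁻ l : Fin s → ℝ, decay 1 (q - ∑ i, l i) * ∏ i, decay 1 (l i) ≤
      C * decay b q := fun q => by
    refine le_trans (le_of_eq ?_) (h q)
    -- Reflecting `l` turns the difference of momenta into a sum.
    rw [← lintegral_neg_eq_self]
    refine lintegral_congr fun l => ?_
    simp [decay_neg]
  have hP : ∀ n : ℕ, Measurable fun k : Fin n → ℝ => ∏ i, decay 1 (k i) := fun n =>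
    Finset.measurable_prod _ fun i _ => by fun_prop
  have hM : ∀ (n : ℕ) (a : ℝ) (f : (Fin n → ℝ) → ℝ), Measurable f →
      Measurable fun k : Fin n → ℝ => decay a (f k) * ∏ i, decay 1 (k i) := fun n a f hf =>
    ((measurable_decay a).comp hf).mul (hP n)
  calc _ = ∫⁻ k : Fin r → ℝ, (∏ i, decay 1 (k i)) *
        ∫⁻ l : Fin s → ℝ, decay 1 ((∑ i, k i) - ∑ i, l i) * ∏ i, decay 1 (l i) := by
        rw [Measure.volume_eq_prod, lintegral_prod]
        · refine lintegral_congr fun k => ?_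
          rw [← lintegral_const_mul _ (hM s 1 (fun l => (∑ i, k i) - ∑ i, l i) (by fun_prop))]
          refine lintegral_congr fun l => ?_
          ring
        · exact (Measurable.mul (by fun_prop)
            (((hP r).comp measurable_fst).mul ((hP s).comp measurable_snd))).aemeasurable
    _ ≤ ∫⁻ k : Fin r → ℝ, C * (decay b (0 + ∑ i, k i) * ∏ i, decay 1 (k i)) := by
        refine lintegral_mono fun k => ?_
        calc _ ≤ (∏ i, decay 1 (k i)) * (C * decay b (∑ i, k i)) := by gcongr; exact hneg _
          _ = _ := by rw [zero_add]; ring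
    _ ≤ C * (C' * decay b' 0) := by
        rw [lintegral_const_mul _ (hM r b (fun k => 0 + ∑ i, k i) (by fun_prop))]
        gcongr
        exact h' 0
    _ < ⊤ := by
        simp [decay, ENNReal.mul_lt_top, hC.lt_top, hC'.lt_top]

/-- The kernel of a Wick monomial of the field, for a general momentum profile `u`. -/
def profileKernel (m : ℝ) (r s : ℕ) (u : ℝ → ℂ) (z : (Fin r → ℝ) × (Fin s → ℝ)) : ℂ :=
  (((4 * Real.pi) ^ 2)⁻¹ : ℝ) * u ((∑ i, z.1 i) - ∑ i, z.2 i) *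
    (((∏ i, (omega m (z.1 i)) ^ (-(1 / 2) : ℝ)) *
      ∏ i, (omega m (z.2 i)) ^ (-(1 / 2) : ℝ) : ℝ) : ℂ)

/-! ### Square integrability of the field kernels, by comparison with one reference profile -/

theorem continuous_omega (m : ℝ) : Continuous (omega m) := by
  unfold omega
  fun_prop

theorem measurable_profileKernel (m : ℝ) (r s : ℕ) {u : ℝ → ℂ} (hu : Measurable u) :
    Measurable (profileKernel m r s u) := by
  have hP : ∀ n : ℕ, Measurable fun k : Fin n → ℝ =>
      ∏ i, (omega m (k i)) ^ (-(1 / 2) : ℝ) := fun n =>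
    Finset.measurable_prod _ fun i _ =>
      ((continuous_omega m).measurable.comp (measurable_pi_apply i)).pow_const _
  refine Measurable.mul (Measurable.const_mul (hu.comp (by fun_prop)) _) ?_
  exact Complex.measurable_ofReal.comp
    (((hP r).comp measurable_fst).mul ((hP s).comp measurable_snd))

theorem norm_profileKernel_le {m : ℝ} {r s : ℕ} {u v : ℝ → ℂ} {A : ℝ}
    (h : ∀ q, ‖u q‖ ≤ A * ‖v q‖) (z : (Fin r → ℝ) × (Fin s → ℝ)) :
    ‖profileKernel m r s u z‖ ≤ A * ‖profileKernel m r s v z‖ := by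
  unfold profileKernel
  rw [norm_mul, norm_mul, norm_mul, norm_mul]
  calc _ ≤ ‖((((4 * Real.pi) ^ 2)⁻¹ : ℝ) : ℂ)‖ * (A * ‖v ((∑ i, z.1 i) - ∑ i, z.2 i)‖) * _ :=
        mul_le_mul_of_nonneg_right (mul_le_mul_of_nonneg_left (h _) (norm_nonneg _))
          (norm_nonneg _)
    _ = _ := by ring

/-- The momentum profile `(1 + |q|)⁻¹`. -/
def profileInv (q : ℝ) : ℂ := ((1 + |q|)⁻¹ : ℝ)

theorem norm_profileInv (q : ℝ) : ‖profileInv q‖ = (1 + |q|)⁻¹ := by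
  rw [profileInv, Complex.norm_real, Real.norm_eq_abs, abs_of_nonneg (by positivity)]

theorem measurable_profileInv : Measurable profileInv := by
  unfold profileInv
  fun_prop

/-- From `m ≤ ω` and `|k| ≤ ω` follows `1 + |k| ≤ (1 + m⁻¹) ω`. -/
theorem omega_rpow_sq_le {m : ℝ} (hm : 0 < m) (k : ℝ) :
    ENNReal.ofReal (((omega m k) ^ (-(1 / 2) : ℝ)) ^ 2) ≤
      ENNReal.ofReal (1 + m⁻¹) * decay 1 k := by
  have hω : m ≤ omega m k := le_omega m k
  have hk : |k| ≤ omega m k := Real.abs_le_sqrt (by nlinarith [sq_nonneg m])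
  have h0 : 0 < omega m k := hm.trans_le hω
  rw [decay, ← ENNReal.ofReal_mul (by positivity)]
  refine ENNReal.ofReal_le_ofReal ?_
  rw [← Real.rpow_natCast, ← Real.rpow_mul h0.le]
  norm_num
  rw [Real.rpow_neg_one, Real.rpow_neg_one, ← div_eq_mul_inv, inv_eq_one_div,
    div_le_div_iff₀ h0 (by positivity)]
  have : 1 ≤ m⁻¹ * omega m k := by
    rw [inv_mul_eq_div, one_le_div hm]
    exact hω
  linarith

theorem memLp_profileKernel_inv {m : ℝ} (hm : 0 < m) (r s : ℕ) :
    MemLp (profileKernel m r s profileInv) 2 volume := by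
  refine ⟨(measurable_profileKernel m r s measurable_profileInv).aestronglyMeasurable, ?_⟩
  rw [eLpNorm_two_eq]
  refine ENNReal.rpow_lt_top_of_nonneg (by norm_num) (ne_of_lt ?_)
  have hP : ∀ (n : ℕ) (k : Fin n → ℝ),
      ENNReal.ofReal ((∏ i, (omega m (k i)) ^ (-(1 / 2) : ℝ)) ^ 2) ≤
        ENNReal.ofReal (1 + m⁻¹) ^ n * ∏ i, decay 1 (k i) := fun n k => by
    rw [← Finset.prod_pow, ENNReal.ofReal_prod_of_nonneg fun i _ => sq_nonneg _]
    calc _ ≤ ∏ i, (ENNReal.ofReal (1 + m⁻¹) * decay 1 (k i)) :=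
          Finset.prod_le_prod' fun i _ => omega_rpow_sq_le hm _
      _ = _ := by rw [Finset.prod_mul_distrib]; simp
  set c : ℝ≥0∞ := ENNReal.ofReal ((((4 * Real.pi) ^ 2)⁻¹) ^ 2) with hc
  have hle : ∀ z : (Fin r → ℝ) × (Fin s → ℝ), ‖profileKernel m r s profileInv z‖ₑ ^ (2 : ℝ) ≤
      (c * (ENNReal.ofReal (1 + m⁻¹) ^ r * ENNReal.ofReal (1 + m⁻¹) ^ s)) *
      (decay 1 ((∑ i, z.1 i) - ∑ i, z.2 i) *
        ((∏ i, decay 1 (z.1 i)) * ∏ i, decay 1 (z.2 i))) := fun z => by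
    have h1 : ‖profileKernel m r s profileInv z‖ₑ ^ (2 : ℝ) =
        c * ENNReal.ofReal (((1 + |(∑ i, z.1 i) - ∑ i, z.2 i|)⁻¹) ^ 2) *
        (ENNReal.ofReal ((∏ i, (omega m (z.1 i)) ^ (-(1 / 2) : ℝ)) ^ 2) *
          ENNReal.ofReal ((∏ i, (omega m (z.2 i)) ^ (-(1 / 2) : ℝ)) ^ 2)) := by
      rw [hc, ← ENNReal.ofReal_mul (by positivity), ← ENNReal.ofReal_mul (by positivity),
        ← ENNReal.ofReal_mul (by positivity), ENNReal.rpow_two, ← ofReal_norm,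
        ← ENNReal.ofReal_pow (norm_nonneg _), profileKernel, norm_mul, norm_mul,
        norm_profileInv, Complex.norm_real, Complex.norm_real, Real.norm_eq_abs,
        Real.norm_eq_abs, mul_pow, mul_pow, sq_abs, sq_abs, mul_pow (∏ i, _)]
    -- One of the two powers of decay is given up: exponent one suffices and fits the range `a ≤ 1`
    -- of the convolution bound.
    have h2 : ENNReal.ofReal (((1 + |(∑ i, z.1 i) - ∑ i, z.2 i|)⁻¹) ^ 2) ≤
        decay 1 ((∑ i, z.1 i) - ∑ i, z.2 i) := by
      rw [decay, Real.rpow_neg_one]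
      refine ENNReal.ofReal_le_ofReal (pow_le_of_le_one (by positivity) ?_ two_ne_zero)
      exact inv_le_one_of_one_le₀ (by linarith [abs_nonneg ((∑ i, z.1 i) - ∑ i, z.2 i)])
    rw [h1]
    calc _ ≤ c * decay 1 ((∑ i, z.1 i) - ∑ i, z.2 i) *
          ((ENNReal.ofReal (1 + m⁻¹) ^ r * ∏ i, decay 1 (z.1 i)) *
            (ENNReal.ofReal (1 + m⁻¹) ^ s * ∏ i, decay 1 (z.2 i))) := by
          gcongr
          · exact hP r z.1
          · exact hP s z.2
      _ = _ := by ring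
  have hfin : c * (ENNReal.ofReal (1 + m⁻¹) ^ r * ENNReal.ofReal (1 + m⁻¹) ^ s) ≠ ⊤ :=
    ENNReal.mul_ne_top ENNReal.ofReal_ne_top
      (ENNReal.mul_ne_top (ENNReal.pow_ne_top ENNReal.ofReal_ne_top)
        (ENNReal.pow_ne_top ENNReal.ofReal_ne_top))
  refine (lintegral_mono hle).trans_lt ?_
  rw [lintegral_const_mul' _ _ hfin]
  exact ENNReal.mul_lt_top hfin.lt_top (lintegral_decay_sub_lt_top r s)

theorem memLp_profileKernel {m : ℝ} (hm : 0 < m) (r s : ℕ) {u : ℝ → ℂ} (hu : Measurable u)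
    {A : ℝ} (h : ∀ q, ‖u q‖ ≤ A * ‖profileInv q‖) :
    MemLp (profileKernel m r s u) 2 volume :=
  (memLp_profileKernel_inv hm r s).of_le_mul
    (measurable_profileKernel m r s hu).aestronglyMeasurable
    (Filter.Eventually.of_forall (norm_profileKernel_le h))

end PhiFour

namespace PhiFour

/-! ### Smooth compactly supported functions of space and time -/

/-- Smooth compactly supported real functions on the plane. -/
structure TestFun : Type where
  /-- The underlying function. -/
  toFun : ℝ × ℝ → ℝ
  contDiff : ContDiff ℝ ∞ toFun
  hasCompactSupport : HasCompactSupport toFun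

namespace TestFun

instance : CoeFun TestFun fun _ => ℝ × ℝ → ℝ := ⟨toFun⟩

/-- The derivative in the direction `v`. -/
def dirDeriv (v : ℝ × ℝ) (g : TestFun) : TestFun :=
  ⟨fun z => fderiv ℝ g z v,
    (g.contDiff.fderiv_right (m := ∞) (by simp)).clm_apply contDiff_const,
    g.hasCompactSupport.fderiv_apply ℝ v⟩

theorem dirDeriv_apply (v : ℝ × ℝ) (g : TestFun) (z : ℝ × ℝ) :
    g.dirDeriv v z = fderiv ℝ g z v := rfl

/-- The partial derivative in the space variable. -/
abbrev dx (g : TestFun) : TestFun := g.dirDeriv (1, 0)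

/-- The partial derivative in the time variable. -/
abbrev dt (g : TestFun) : TestFun := g.dirDeriv (0, 1)

theorem hasFDerivAt (g : TestFun) (z : ℝ × ℝ) : HasFDerivAt g (fderiv ℝ g z) z :=
  (g.contDiff.differentiable (by simp) z).hasFDerivAt

/-- Needed to identify the space derivative of the Taylor remainder of `g` in time with the Taylor
remainder of `g.dx`. -/
theorem dirDeriv_comm (g : TestFun) (u v : ℝ × ℝ) (z : ℝ × ℝ) :
    (g.dirDeriv u).dirDeriv v z = (g.dirDeriv v).dirDeriv u z := by
  have hd : DifferentiableAt ℝ (fderiv ℝ g) z :=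
    (g.contDiff.fderiv_right (m := ∞) (by simp)).differentiable (by simp) z
  have h : ∀ u v : ℝ × ℝ, (g.dirDeriv u).dirDeriv v z = fderiv ℝ (fderiv ℝ g) z v u := by
    intro u v
    rw [dirDeriv_apply]
    change fderiv ℝ (fun z => fderiv ℝ g z u) z v = _
    rw [fderiv_clm_apply hd (differentiableAt_const u)]
    simp
  rw [h, h]
  exact (g.contDiff.contDiffAt.isSymmSndFDerivAt (by
    rw [minSmoothness_of_isRCLikeNormedField]
    exact WithTop.coe_le_coe.mpr le_top)).eq v u

theorem hasDerivAt_space (g : TestFun) (x t : ℝ) :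
    HasDerivAt (fun x => g (x, t)) (g.dx (x, t)) x :=
  (g.hasFDerivAt (x, t)).comp_hasDerivAt x ((hasDerivAt_id x).prodMk (hasDerivAt_const x t))

theorem hasDerivAt_time (g : TestFun) (x t : ℝ) :
    HasDerivAt (fun t => g (x, t)) (g.dt (x, t)) t :=
  (g.hasFDerivAt (x, t)).comp_hasDerivAt t ((hasDerivAt_const t x).prodMk (hasDerivAt_id t))

theorem exists_bound (g : TestFun) : ∃ C, 0 ≤ C ∧ ∀ z, |g z| ≤ C := by
  obtain ⟨C, hC⟩ := g.hasCompactSupport.exists_bound_of_continuous g.contDiff.continuous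
  exact ⟨C, (norm_nonneg _).trans (hC 0), hC⟩

theorem exists_eq_zero (g : TestFun) : ∃ R, 0 ≤ R ∧ ∀ x t, R < |x| → g (x, t) = 0 := by
  obtain ⟨R, hR⟩ := g.hasCompactSupport.isCompact.isBounded.exists_norm_le
  refine ⟨max R 0, le_max_right _ _, fun x t hx => ?_⟩
  by_contra h
  have h1 := hR (x, t) (subset_tsupport _ h)
  have h2 : |x| ≤ ‖(x, t)‖ := le_max_left _ _
  exact absurd (hx.trans_le (h2.trans h1)) (not_lt.mpr (le_max_left _ _))

theorem exists_taylor_bound (g : TestFun) : ∃ C, 0 ≤ C ∧ ∀ x t h,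
    |g (x, t + h) - g (x, t) - h * g.dt (x, t)| ≤ C * h ^ 2 := by
  obtain ⟨C, hC0, hC⟩ := g.dt.dt.exists_bound
  refine ⟨C, hC0, fun x t h => ?_⟩
  have h1 : ∀ s, |g.dt (x, s) - g.dt (x, t)| ≤ C * |s - t| := fun s =>
    convex_univ.norm_image_sub_le_of_norm_hasDerivWithin_le
      (fun y _ => (g.dt.hasDerivAt_time x y).hasDerivWithinAt) (fun y _ => hC (x, y))
      (Set.mem_univ t) (Set.mem_univ s)
  -- The mean value inequality for `s ↦ g (x, s) - s * g.dt (x, t)`, whose derivative is at most `C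
  -- * |h|` between `t` and `t + h` by `h1`.
  have h2 : ‖(g (x, t + h) - (t + h) * g.dt (x, t)) - (g (x, t) - t * g.dt (x, t))‖ ≤
      C * |h| * ‖t + h - t‖ :=
    (convex_uIcc t (t + h)).norm_image_sub_le_of_norm_hasDerivWithin_le
      (f := fun s => g (x, s) - s * g.dt (x, t))
      (f' := fun s => g.dt (x, s) - 1 * g.dt (x, t))
      (fun y _ => ((g.hasDerivAt_time x y).sub
        ((hasDerivAt_id y).mul_const (g.dt (x, t)))).hasDerivWithinAt)
      (fun y hy => by
        rw [one_mul]
        refine (h1 y).trans (mul_le_mul_of_nonneg_left ?_ hC0)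
        simpa using Set.abs_sub_left_of_mem_uIcc hy)
      Set.left_mem_uIcc Set.right_mem_uIcc
  have h3 : C * |h| * ‖t + h - t‖ = C * h ^ 2 := by
    rw [add_sub_cancel_left, Real.norm_eq_abs, mul_assoc, ← sq, sq_abs]
  rw [h3, Real.norm_eq_abs] at h2
  convert h2 using 2
  ring

end TestFun

/-! ### Fourier transforms of smooth bumps -/

theorem norm_integral_le_of_support {f : ℝ → ℂ} {R C : ℝ} (hR : 0 ≤ R)
    (h0 : ∀ x, R < |x| → f x = 0) (hC : ∀ x, ‖f x‖ ≤ C) : ‖∫ x, f x‖ ≤ 2 * R * C := by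
  have h : ∫ x in Set.Icc (-R) R, f x = ∫ x, f x :=
    setIntegral_eq_integral_of_forall_compl_eq_zero fun x hx => h0 x (by
      by_contra hx'
      exact hx (abs_le.mp (not_lt.mp hx')))
  rw [← h]
  refine (norm_setIntegral_le_of_norm_le_const (by simp) fun x _ => hC x).trans (le_of_eq ?_)
  rw [Real.volume_real_Icc_of_le (by linarith)]
  ring

theorem norm_exp_neg_I_mul (q x : ℝ) : ‖Complex.exp (-(Complex.I * q * x))‖ = 1 := by
  have : -(Complex.I * q * x) = ((-(q * x) : ℝ) : ℂ) * Complex.I := by push_cast; ring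
  rw [this, Complex.norm_exp_ofReal_mul_I]

theorem integrable_exp_mul {ρ : ℝ → ℝ} {R : ℝ} (hρ : Continuous ρ)
    (h0 : ∀ x, R < |x| → ρ x = 0) (q : ℝ) :
    Integrable fun x : ℝ => Complex.exp (-(Complex.I * q * x)) * (ρ x : ℂ) := by
  refine Continuous.integrable_of_hasCompactSupport (by fun_prop) ?_
  refine HasCompactSupport.intro (isCompact_Icc (a := -R) (b := R)) fun x hx => ?_
  rw [h0 x (by
    by_contra hx'
    exact hx (abs_le.mp (not_lt.mp hx')))]
  simp

/-- The trivial bound `2 * R * C` holds for the transforms of `ρ` and `ρ'`; integration by parts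
turns the second into a bound on `|q|` times the first, and the sum gives `4 * R * C`. The explicit
constant lets a factor `h ^ 2` in `C` pass through. -/
theorem norm_fourier_le {ρ ρ' : ℝ → ℝ} {R C : ℝ} (hR : 0 ≤ R)
    (hd : ∀ x, HasDerivAt ρ (ρ' x) x) (hc : Continuous ρ')
    (h0 : ∀ x, R < |x| → ρ x = 0) (h0' : ∀ x, R < |x| → ρ' x = 0)
    (hC : ∀ x, |ρ x| ≤ C) (hC' : ∀ x, |ρ' x| ≤ C) (q : ℝ) :
    ‖∫ x : ℝ, Complex.exp (-(Complex.I * q * x)) * (ρ x : ℂ)‖ ≤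
      4 * R * C * ‖profileInv q‖ := by
  have hcρ : Continuous ρ := continuous_iff_continuousAt.mpr fun x => (hd x).continuousAt
  have bound : ∀ {f : ℝ → ℝ}, (∀ x, R < |x| → f x = 0) → (∀ x, |f x| ≤ C) →
      ‖∫ x : ℝ, Complex.exp (-(Complex.I * q * x)) * (f x : ℂ)‖ ≤ 2 * R * C := by
    intro f hf0 hfC
    refine norm_integral_le_of_support hR (fun x hx => by simp [hf0 x hx]) fun x => ?_
    rw [norm_mul, norm_exp_neg_I_mul, one_mul, Complex.norm_real]
    exact hfC x
  have hexp : ∀ x : ℝ, HasDerivAt (fun x : ℝ => Complex.exp (-(Complex.I * q * x)))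
      (-(Complex.I * q) * Complex.exp (-(Complex.I * q * x))) x := by
    intro x
    have h1 : HasDerivAt (fun x : ℝ => -(Complex.I * q * (x : ℂ))) (-(Complex.I * q)) x := by
      have h2 := ((Complex.ofRealCLM.hasDerivAt (x := x)).const_mul (Complex.I * q)).neg
      simp only [Complex.ofRealCLM_apply, Complex.ofReal_one, mul_one] at h2
      exact h2
    simpa [mul_comm] using h1.cexp
  have hparts := integral_mul_deriv_eq_deriv_mul_of_integrable
    (u := fun x : ℝ => Complex.exp (-(Complex.I * q * x))) (v := fun x : ℝ => (ρ x : ℂ))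
    (u' := fun x : ℝ => -(Complex.I * q) * Complex.exp (-(Complex.I * q * x)))
    (v' := fun x : ℝ => (ρ' x : ℂ)) (fun x _ => hexp x) (fun x _ => (hd x).ofReal_comp)
    (integrable_exp_mul hc h0' q)
    (by
      refine ((integrable_exp_mul hcρ h0 q).const_mul (-(Complex.I * q))).congr
        (Filter.Eventually.of_forall fun x => ?_)
      simp only [Pi.mul_apply]
      ring)
    (integrable_exp_mul hcρ h0 q)
  have h1 := bound h0 hC
  have h2 := bound h0' hC'
  rw [hparts] at h2
  simp only [mul_assoc (-(Complex.I * (q : ℂ)))] at h2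
  rw [integral_const_mul, norm_neg, norm_mul, norm_neg, norm_mul, Complex.norm_I, one_mul,
    Complex.norm_real, Real.norm_eq_abs] at h2
  rw [norm_profileInv, ← div_eq_mul_inv, le_div_iff₀ (by positivity)]
  linarith

theorem measurable_spaceFourier (g : TestFun) (t : ℝ) : Measurable (spaceFourier g t) := by
  have hg := g.contDiff.continuous
  have h : Continuous fun z : ℝ × ℝ =>
      Complex.exp (-(Complex.I * z.1 * z.2)) * (g (z.2, t) : ℂ) := by fun_prop
  exact (h.stronglyMeasurable.integral_prod_right (ν := volume)).measurable

theorem integrable_spaceFourier (g : TestFun) (t q : ℝ) :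
    Integrable fun x : ℝ => Complex.exp (-(Complex.I * q * x)) * (g (x, t) : ℂ) := by
  obtain ⟨R, -, h⟩ := g.exists_eq_zero
  have hg := g.contDiff.continuous
  exact integrable_exp_mul (by fun_prop) (fun x => h x t) q

theorem exists_norm_spaceFourier_le (g : TestFun) :
    ∃ A, ∀ t q, ‖spaceFourier g t q‖ ≤ A * ‖profileInv q‖ := by
  obtain ⟨R, hR, h0⟩ := g.exists_eq_zero
  obtain ⟨R', hR', h0'⟩ := g.dx.exists_eq_zero
  obtain ⟨C, hC0, hC⟩ := g.exists_bound
  obtain ⟨C', hC0', hC'⟩ := g.dx.exists_bound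
  have hg := g.dx.contDiff.continuous
  exact ⟨4 * max R R' * max C C', fun t q => norm_fourier_le (le_max_of_le_left hR)
    (fun x => g.hasDerivAt_space x t) (by fun_prop)
    (fun x hx => h0 x t ((le_max_left _ _).trans_lt hx))
    (fun x hx => h0' x t ((le_max_right _ _).trans_lt hx))
    (fun x => (hC _).trans (le_max_left _ _)) (fun x => (hC' _).trans (le_max_right _ _)) q⟩

/-- The left side is the transform of the Taylor remainder of `g` in time. This remainder and its
space derivative are both `O(h²)` uniformly and vanish outside one fixed interval. -/
theorem exists_spaceFourier_taylor_bound (g : TestFun) : ∃ A, ∀ t h q,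
    ‖spaceFourier g (t + h) q - spaceFourier g t q - h * spaceFourier g.dt t q‖ ≤
      A * h ^ 2 * ‖profileInv q‖ := by
  obtain ⟨R₁, hR₁, h₁⟩ := g.exists_eq_zero
  obtain ⟨R₂, -, h₂⟩ := g.dx.exists_eq_zero
  obtain ⟨R₃, -, h₃⟩ := g.dt.exists_eq_zero
  obtain ⟨R₄, -, h₄⟩ := g.dx.dt.exists_eq_zero
  obtain ⟨C, hC0, hC⟩ := g.exists_taylor_bound
  obtain ⟨C', hC0', hC'⟩ := g.dx.exists_taylor_bound
  set R := max (max R₁ R₂) (max R₃ R₄) with hRdef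
  have e₁ : R₁ ≤ R := (le_max_left _ _).trans (le_max_left _ _)
  have e₂ : R₂ ≤ R := (le_max_right _ _).trans (le_max_left _ _)
  have e₃ : R₃ ≤ R := (le_max_left _ _).trans (le_max_right _ _)
  have e₄ : R₄ ≤ R := (le_max_right _ _).trans (le_max_right _ _)
  have hc1 := g.dx.contDiff.continuous
  have hc2 := g.dx.dt.contDiff.continuous
  refine ⟨4 * R * max C C', fun t h q => ?_⟩
  have heq : spaceFourier g (t + h) q - spaceFourier g t q - h * spaceFourier g.dt t q =
      ∫ x : ℝ, Complex.exp (-(Complex.I * q * x)) *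
        ((g (x, t + h) - g (x, t) - h * g.dt (x, t) : ℝ) : ℂ) := by
    have hsub : Integrable fun x : ℝ => Complex.exp (-(Complex.I * q * x)) *
        (g (x, t + h) : ℂ) - Complex.exp (-(Complex.I * q * x)) * (g (x, t) : ℂ) :=
      (integrable_spaceFourier g _ q).sub (integrable_spaceFourier g _ q)
    unfold spaceFourier
    rw [← integral_const_mul, ← integral_sub (integrable_spaceFourier g _ q)
      (integrable_spaceFourier g _ q), ← integral_sub hsub
      ((integrable_spaceFourier g.dt _ q).const_mul _)]
    refine integral_congr_ae (Filter.Eventually.of_forall fun x => ?_)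
    push_cast
    ring
  rw [heq]
  refine (norm_fourier_le (R := R) (C := max C C' * h ^ 2) (hR₁.trans e₁)
    (ρ' := fun x => g.dx (x, t + h) - g.dx (x, t) - h * g.dx.dt (x, t))
    (fun x => ?_) (by fun_prop) (fun x hx => ?_) (fun x hx => ?_) (fun x => ?_) (fun x => ?_)
    q).trans (le_of_eq (by ring))
  · have h3 := (g.dt.hasDerivAt_space x t).const_mul h
    rw [show g.dt.dx (x, t) = g.dx.dt (x, t) from g.dirDeriv_comm _ _ _] at h3
    exact ((g.hasDerivAt_space x (t + h)).sub (g.hasDerivAt_space x t)).sub h3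
  · rw [h₁ _ _ (e₁.trans_lt hx), h₁ _ _ (e₁.trans_lt hx), h₃ _ _ (e₃.trans_lt hx)]
    ring
  · rw [h₂ _ _ (e₂.trans_lt hx), h₂ _ _ (e₂.trans_lt hx), h₄ _ _ (e₄.trans_lt hx)]
    ring
  · exact (hC x t h).trans (by gcongr; exact le_max_left _ _)
  · exact (hC' x t h).trans (by gcongr; exact le_max_right _ _)

/-! ### Smooth dependence on time -/

section Smooth

variable {m : ℝ} (hm : 0 < m) (r s : ℕ)

theorem memLp_spaceFourier (hm : 0 < m) (r s : ℕ) (g : TestFun) (t : ℝ) :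
    MemLp (profileKernel m r s (spaceFourier g t)) 2 volume :=
  memLp_profileKernel hm r s (measurable_spaceFourier g t)
    ((exists_norm_spaceFourier_le g).choose_spec t)

/-- The kernel of a Wick monomial of the interaction, as a square integrable function. -/
def interactionKernel (g : TestFun) (t : ℝ) : KernelL2 r s :=
  (memLp_spaceFourier hm r s g t).toLp

theorem interactionKernel_ae (g : TestFun) (t : ℝ) :
    ∀ᵐ z : (Fin r → ℝ) × (Fin s → ℝ), kernelFun (interactionKernel hm r s g t) z.1 z.2 =
      phi4Kernel m g t r s z.1 z.2 :=
  (memLp_spaceFourier hm r s g t).coeFn_toLp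

/-- The kernel is linear in its momentum profile, so the pointwise Taylor bound becomes an `L²`
remainder of at most `A * h ^ 2` times the norm of the reference kernel `P`. -/
theorem hasDerivAt_interactionKernel (g : TestFun) (t : ℝ) :
    HasDerivAt (interactionKernel hm r s g) (interactionKernel hm r s g.dt t) t := by
  rw [hasDerivAt_iff_isLittleO_nhds_zero]
  obtain ⟨A, hA⟩ := exists_spaceFourier_taylor_bound g
  set P := (memLp_profileKernel_inv hm r s).toLp with hP
  have hbound : ∀ h : ℝ, ‖interactionKernel hm r s g (t + h) - interactionKernel hm r s g t -
      h • interactionKernel hm r s g.dt t‖ ≤ A * ‖P‖ * ‖h ^ 2‖ := by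
    intro h
    have key : ‖interactionKernel hm r s g (t + h) - interactionKernel hm r s g t -
      h • interactionKernel hm r s g.dt t‖ ≤ A * h ^ 2 * ‖P‖ := by
      refine Lp.norm_le_mul_norm_of_ae_le_mul ?_
      filter_upwards [Lp.coeFn_sub (interactionKernel hm r s g (t + h) -
          interactionKernel hm r s g t) (h • interactionKernel hm r s g.dt t),
        Lp.coeFn_sub (interactionKernel hm r s g (t + h)) (interactionKernel hm r s g t),
        Lp.coeFn_smul h (interactionKernel hm r s g.dt t),
        (memLp_spaceFourier hm r s g (t + h)).coeFn_toLp,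
        (memLp_spaceFourier hm r s g t).coeFn_toLp,
        (memLp_spaceFourier hm r s g.dt t).coeFn_toLp,
        (memLp_profileKernel_inv hm r s).coeFn_toLp] with z h1 h2 h3 h4 h5 h6 h7
      rw [h1, Pi.sub_apply, h2, Pi.sub_apply, h3, Pi.smul_apply, h7]
      unfold interactionKernel
      rw [h4, h5, h6]
      refine le_trans (le_of_eq ?_) (norm_profileKernel_le (u := fun q =>
        spaceFourier g (t + h) q - spaceFourier g t q - h * spaceFourier g.dt t q)
        (fun q => hA t h q) z)
      congr 1
      simp only [profileKernel, Complex.real_smul]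
      ring
    refine key.trans (le_of_eq ?_)
    rw [Real.norm_eq_abs, abs_of_nonneg (sq_nonneg h)]
    ring
  exact (Asymptotics.IsBigO.of_bound _ (Filter.Eventually.of_forall hbound)).trans_isLittleO
    (Asymptotics.isLittleO_pow_id one_lt_two)

theorem contDiff_interactionKernel (g : TestFun) :
    ContDiff ℝ ∞ (interactionKernel hm r s g) := by
  rw [contDiff_infty]
  intro n
  induction n generalizing g with
  | zero =>
    exact contDiff_zero.mpr (continuous_iff_continuousAt.mpr fun t =>
      (hasDerivAt_interactionKernel hm r s g t).continuousAt)
  | succ n ih =>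
    have hderiv : deriv (interactionKernel hm r s g) = interactionKernel hm r s g.dt :=
      funext fun t => (hasDerivAt_interactionKernel hm r s g t).deriv
    push_cast
    refine contDiff_succ_iff_deriv.mpr
      ⟨fun t => (hasDerivAt_interactionKernel hm r s g t).differentiableAt, by simp, ?_⟩
    rw [hderiv]
    exact ih g.dt

end Smooth

/-! ### The Hamiltonian -/

/-- The Hamiltonian `H₀ + V_g(t)` as a bounded operator from `ℱ₊₂` to `ℱ₋₂`. -/
def hamiltonian {m : ℝ} (hm : 0 < m) (g : TestFun) (t : ℝ) : FPlus m →L[ℂ] FMinus m :=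
  inclMinus m ∘L freeHCLM m + ∑ j : Fin 5, (Nat.choose 4 j : ℂ) •
    wickCLM hm (Nat.add_sub_of_le (Nat.lt_succ_iff.mp j.2))
      (interactionKernel hm j (4 - j) g t)

theorem hamiltonian_apply {m : ℝ} (hm : 0 < m) (g : TestFun) (t : ℝ) (φ ψ : FPlus m) :
    hamiltonian hm g t ψ φ = inner ℂ (inclPlus m φ) (freeHLin m ψ) +
      interactionForm m g t (inclPlus m φ) (inclPlus m ψ) := by
  have h : interactionForm m g t (inclPlus m φ) (inclPlus m ψ) =
      ∑ j : Fin 5, (Nat.choose 4 j : ℂ) * wickForm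
        (kernelFun (interactionKernel hm j (4 - j) g t)) (inclPlus m φ) (inclPlus m ψ) := by
    rw [interactionForm, Finset.sum_range]
    refine Finset.sum_congr rfl fun j _ => ?_
    rw [wickForm_congr_ae (interactionKernel_ae hm j (4 - j) g t)]
  rw [h]
  simp only [hamiltonian, add_apply, sum_apply,
    smul_apply, wickCLM_apply, smul_eq_mul]
  rfl

/-- A constant plus bounded linear images of smooth `L²`-valued curves; the complex linear maps are
restricted to real scalars because time is real. -/
theorem contDiff_hamiltonian {m : ℝ} (hm : 0 < m) (g : TestFun) :
    ContDiff ℝ ∞ (hamiltonian hm g) := by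
  refine contDiff_const.add (ContDiff.sum fun j _ => ?_)
  refine ContDiff.const_smul (Nat.choose 4 j : ℂ) ?_
  have h : ContDiff ℂ ∞ (wickCLM hm (Nat.add_sub_of_le (Nat.lt_succ_iff.mp j.2))) :=
    ContinuousLinearMap.contDiff (𝕜 := ℂ) (E := KernelL2 j (4 - j))
      (F := FPlus m →L[ℂ] FMinus m) _
  exact (h.restrict_scalars ℝ).comp (contDiff_interactionKernel hm _ _ g)

theorem exists_hamiltonian_eq_inclMinus {m : ℝ} (hm : 0 < m) (g : TestFun) (t : ℝ)
    (ψ : FPlus m) (hψ : inclPlus m ψ ∈ domInfty m) :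
    ∃ η : Fock, hamiltonian hm g t ψ = inclMinus m η := by
  -- Two powers of `H₀` control the weight `(n+1)²` of a quartic monomial.
  have hψ2 : inclPlus m ψ ∈ domPow m 2 := Set.mem_iInter.mp hψ 2
  choose C hC using fun j : Fin 5 => exists_norm_wickForm_le hm
    (Nat.add_sub_of_le (Nat.lt_succ_iff.mp j.2)) (interactionKernel hm j (4 - j) g t) ψ hψ2
  refine exists_eq_inclMinus _ (‖freeHCLM m ψ‖ + ∑ j : Fin 5, (Nat.choose 4 j : ℝ) * C j)
    fun φ => ?_
  simp only [hamiltonian, add_apply, sum_apply,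
    smul_apply, wickCLM_apply, smul_eq_mul, ContinuousLinearMap.comp_apply,
    inclMinus_apply]
  rw [add_mul, Finset.sum_mul]
  refine (norm_add_le _ _).trans (add_le_add ?_ ((norm_sum_le _ _).trans
    (Finset.sum_le_sum fun j _ => ?_)))
  · rw [mul_comm]
    exact norm_inner_le_norm (𝕜 := ℂ) (inclPlus m φ) _
  · rw [norm_mul, Complex.norm_natCast, mul_assoc]
    gcongr
    exact hC j φ

end PhiFour

end

/-! ### The main theorem -/

theorem theorem3p1 (m : ℝ) (hm : 0 < m) (g : ℝ × ℝ → ℝ) (hg : ContDiff ℝ ∞ g)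
    (hsupp : HasCompactSupport g) (hpos : ∀ z, 0 ≤ g z) :
    ∃ H : ℝ → (PhiFour.FPlus m →L[ℂ] PhiFour.FMinus m),
      -- `H t` is the operator `H₀ + V_g(t)` from `ℱ₊₂` to `ℱ₋₂`
      (∀ (t : ℝ) (φ ψ : PhiFour.FPlus m),
        (∀ j ≤ 4, PhiFour.WickConverges (PhiFour.phi4Kernel m g t j (4 - j))
          (PhiFour.inclPlus m φ) (PhiFour.inclPlus m ψ)) ∧
        H t ψ φ = inner ℂ (PhiFour.inclPlus m φ) (PhiFour.freeHLin m ψ) +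
          PhiFour.interactionForm m g t (PhiFour.inclPlus m φ) (PhiFour.inclPlus m ψ)) ∧
      -- it maps `D₀` into Fock space, regarded as a subspace of `ℱ₋₂`
      (∀ (t : ℝ) (ψ : PhiFour.FPlus m), PhiFour.inclPlus m ψ ∈ PhiFour.domInfty m →
        ∃ η : PhiFour.Fock, H t ψ = PhiFour.inclMinus m η) ∧
      -- it is infinitely differentiable in `t` for the operator norm
      ContDiff ℝ ∞ H ∧
      -- so `H_g(t) + M` is twice continuously differentiable
      (∀ M : ℝ, ContDiff ℝ 2 fun t =>
        H t + (M : ℂ) • (PhiFour.inclMinus m ∘L PhiFour.inclPlus m)) := by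
  let f : PhiFour.TestFun := ⟨g, hg, hsupp⟩
  refine ⟨PhiFour.hamiltonian hm f, fun t φ ψ => ⟨fun j hj => ?_,
    PhiFour.hamiltonian_apply hm f t φ ψ⟩, PhiFour.exists_hamiltonian_eq_inclMinus hm f,
    PhiFour.contDiff_hamiltonian hm f, fun M => ?_⟩
  · exact (PhiFour.wickConverges_of_domain hm (Nat.add_sub_of_le hj)
      (PhiFour.interactionKernel hm j (4 - j) f t) φ ψ).1.congr_ae
      (PhiFour.interactionKernel_ae hm j (4 - j) f t)
  · exact ((PhiFour.contDiff_hamiltonian hm f).of_le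
      (WithTop.coe_le_coe.mpr le_top)).add contDiff_const
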